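/- **Setting.** Consider a theory with finitely many gauge bosons $W_a^\mu$ (real fields, masses $m_a\ge 0$), a Goldstone boson $\phi_a$ for every $a$ with $m_a\neq 0$, and finitely many further bosonic or fermionic field components with a graded symmetric, parity preserving kinetic operator $K(p)$, in a linear $R_\xi$ gauge. With metric $(+,-,-,-)$ the propagators are $$D_{W_a,\xi}^{\mu\nu}(p)=\frac{-i}{p^2-m_a^2}\Big(g^{\mu\nu}-(1-\xi)\frac{p^\mu p^\nu}{p^2-\xi m_a^2}\Big),\qquad D_{\phi_a,\xi}(p)=\frac{i}{p^2-\xi m_a^2},$$ and $iK(p)^{-1}$ for the remaining fields. The vertices (with $n\ge 3$ lines) are arbitrary graded symmetric, parity conserving, $\xi$-independent functions of the field components and incoming momenta. Let $\mathcal M_\xi$ be the amputated tree-level amplitude, i.e. the sum over all tree Feynman diagrams (with the usual fermion signs), for external particles $e\in E$ ($E$ finite and ordered) with incoming momenta $p_e$, $\sum_e p_e=0$, and given wave functions. For $S\subset E$ put $P_S=\sum_{e\in S}p_e$, and let $\mathcal M_\xi(S;c)$ be the complete tree amplitude with external particles $S$ and one further amputated, off-shell leg with field component $c$ and incoming momentum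 $-P_S$. Call $\xi$ nonsingular if for all $S$ with $|S|,|E\setminus S|\ge2$ one has $P_S^2\ne m_a^2$ and $P_S^2\neq\xi m_a^2$ for all $a$, and $\det K(P_S)\neq 0$. The Ward identities (with one unphysical gauge boson) of the subamplitudes hold at $\xi$ if for all such $S$ and all $a$, with $k=-P_S$, $$-i\,k^\mu\,\mathcal M_\xi(S;W_{a\,\mu}(k))=m_a\,\mathcal M_\xi(S;\phi_a(k))$$ (right-hand side $0$ if $m_a=0$). The external particles are physical if they are on-shell solutions of the free field equations without Goldstone component and with gauge boson polarizations satisfying $\varepsilon\cdot p=0$. **Theorem.** 1. (No double counting.) For every $S\subset E$ with $|S|,|E\setminus S|\ge 2$, joining at the extra leg is a bijection from pairs of a tree diagram with legs $S\cup\{*\}$ and a tree diagram with legs $(E\setminus S)\cup\{*\}$ onto the tree diagrams with legs $E$ that have an internal line separating $S$ from $E\setminus S$. 2. (Factorization.) At every nonsingular $\xi_0$ the amplitude is differentiable in $\xi$ and $$\partial_\xi\mathcal M_\xi\big|_{\xi_0}=\sum_{\{S,S^c\}}\sigma_{S,S^c}\sum_{c,c'}\mathcal M_{\xi_0}(S;c)\,D'_{cc'}(P_S)\,\mathcal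 M_{\xi_0}(S^c;c'),$$ where the sum is over all unordered splittings $E=S\sqcup S^c$ with $|S|,|S^c|\ge 2$, $\sigma_{S,S^c}$ is the sign of the reordering of the external fermions, and $D'$ is the unphysical propagator: $D'^{\mu\nu}=-q^\mu q^\nu\,\frac{i}{(q^2-\xi_0m_a^2)^2}$ for $W_a$, $D'=m_a^2\,\frac{i}{(q^2-\xi_0m_a^2)^2}$ for $\phi_a$, and $0$ otherwise. 3. (Gauge parameter independence.) Let all external particles be physical. If $\xi_0$ is nonsingular and the Ward identities of the subamplitudes hold at $\xi_0$, then $\partial_\xi\mathcal M_\xi|_{\xi_0}=0$. If they hold at every nonsingular real $\xi$, then $\mathcal M_{\xi_1}=\mathcal M_{\xi_2}$ for all nonsingular real $\xi_1,\xi_2$. -/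

import Mathlib

open scoped BigOperators

noncomputable section

namespace RxiGauge

/-! ### Minkowski kinematics -/

/-- Four-momenta, written with upper index `p^μ`. -/
abbrev Momentum : Type := Fin 4 → ℝ

/-- The Minkowski metric `g^{μν} = diag(1, -1, -1, -1)`. -/
def metric (μ ν : Fin 4) : ℝ := if μ = ν then (if μ = 0 then 1 else -1) else 0

/-- The Minkowski square `p² = g_{μν} p^μ p^ν`. -/
def msq (p : Momentum) : ℝ := ∑ μ, metric μ μ * p μ * p μ

/-! ### Fields and Feynman rules -/

/-- The components of the fields of a spontaneously broken gauge theory: a gauge boson `W_a^μ` for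
every `a : G`, a Goldstone boson `φ_a` for every *massive* gauge boson, and the components
(Higgs components, spinor components, ...) of the remaining fields, indexed by `M`. -/
inductive Component {G : Type*} (mass : G → ℝ) (M : Type*)
  | gauge (a : G) (μ : Fin 4)
  | goldstone (a : G) (h : mass a ≠ 0)
  | matter (i : M)

/-- The components as a disjoint union. -/
def Component.equivSum {G : Type*} (mass : G → ℝ) (M : Type*) :
    ((G × Fin 4) ⊕ ({a : G // mass a ≠ 0} ⊕ M)) ≃ Component mass M where
  toFun x := match x with
    | .inl (a, μ) => .gauge a μ
    | .inr (.inl a) => .goldstone a.1 a.2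
    | .inr (.inr i) => .matter i
  invFun c := match c with
    | .gauge a μ => .inl (a, μ)
    | .goldstone a h => .inr (.inl ⟨a, h⟩)
    | .matter i => .inr (.inr i)
  left_inv x := by rcases x with ⟨a, μ⟩ | ⟨a, h⟩ | i <;> rfl
  right_inv c := by cases c <;> rfl

instance {G M : Type*} [Fintype G] [Fintype M] (mass : G → ℝ) : Fintype (Component mass M) :=
  Fintype.ofEquiv _ (Component.equivSum mass M)

/-- Grassmann parity of a component (`true` is fermionic): gauge and Goldstone bosons are bosonic,
`odd` is the parity of the remaining components. -/
def Component.isOdd {G M : Type*} {mass : G → ℝ} (odd : M → Bool) : Component mass M → Bool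
  | .gauge _ _ => false
  | .goldstone _ _ => false
  | .matter i => odd i

/-- The sign picked up when two objects of the given parities are exchanged. -/
def exchangeSign (x y : Bool) : ℂ := if x && y then -1 else 1

/-- The Feynman rules of a theory with gauge bosons `G` and other field components `M`, in a linear
`R_ξ` gauge. All fields are taken in a real (self-conjugate) basis, as one may always do, and
all momenta are incoming. The gauge fixing term is quadratic, so neither the
vertices nor the kinetic operator of the remaining fields depend on `ξ`; the gauge and Goldstone
boson propagators, which do, are given by `propagator` below. Ghosts do not contribute to
tree diagrams with physical external particles.

* `mass a` is the mass of the gauge boson `a`, possibly `0`;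
* `odd` is the Grassmann parity of the remaining field components;
* `kin p` is the kinetic operator of the remaining fields in momentum space, e.g. `p² - m²` for a
  scalar, and built from `p̸ - m` for a fermion. It is the second derivative of the
  quadratic action `½ Φ K Φ`, hence graded symmetric and parity preserving;
* `vertex [(c₁, p₁), ..., (cₙ, pₙ)]` is the vertex (including the factor `i`) of the field
  components `cᵢ` with incoming momenta `pᵢ`; it is an arbitrary graded symmetric function that
  conserves Grassmann parity. Only the values at `n ≥ 3` are used. -/
structure FeynmanRules (G M : Type*) where
  mass : G → ℝ
  mass_nonneg : ∀ a, 0 ≤ mass a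
  odd : M → Bool
  kin : Momentum → Matrix M M ℂ
  kin_symm : ∀ p i j, kin p i j = exchangeSign (odd i) (odd j) * kin (-p) j i
  kin_parity : ∀ p i j, odd i ≠ odd j → kin p i j = 0
  vertex : List (Component mass M × Momentum) → ℂ
  vertex_swap : ∀ l l' x y, vertex (l ++ x :: y :: l') =
    exchangeSign (x.1.isOdd odd) (y.1.isOdd odd) * vertex (l ++ y :: x :: l')
  vertex_parity : ∀ l, Odd (l.countP fun x => x.1.isOdd odd) → vertex l = 0

namespace FeynmanRules

variable {G M : Type*} (Th : FeynmanRules G M)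

/-- The field components of the theory. -/
abbrev Comp : Type _ := Component Th.mass M

/-- Grassmann parity of a field component. -/
abbrev parity (c : Th.Comp) : Bool := c.isOdd Th.odd

open Classical in
/-- The propagators in `R_ξ` gauge. For a gauge boson
`D_W^{μν}(p) = -i/(p² - m²) (g^{μν} - (1 - ξ) p^μ p^ν / (p² - ξ m²))`, for its Goldstone boson
`D_φ(p) = i/(p² - ξ m²)`, and `i K(p)⁻¹` for the remaining fields. -/
def propagator [Fintype M] [DecidableEq M] (ξ : ℝ) (p : Momentum) : Th.Comp → Th.Comp → ℂ
  | .gauge a μ, .gauge b ν =>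
      if a = b then
        -Complex.I / ((msq p - Th.mass a ^ 2 : ℝ) : ℂ) *
          (((metric μ ν - (1 - ξ) * (p μ * p ν) / (msq p - ξ * Th.mass a ^ 2) : ℝ)) : ℂ)
      else 0
  | .goldstone a _, .goldstone b _ =>
      if a = b then Complex.I / ((msq p - ξ * Th.mass a ^ 2 : ℝ) : ℂ) else 0
  | .matter i, .matter j => Complex.I * (Th.kin p)⁻¹ i j
  | _, _ => 0

open Classical in
/-- The *unphysical propagator*, i.e. the coefficient of `δξ` in the propagators: for a gauge boson
`- p^μ p^ν i / (p² - ξ m²)²`, for its Goldstone boson `m² i / (p² - ξ m²)²`, and zero for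
the remaining fields. -/
def unphysicalPropagator (ξ : ℝ) (p : Momentum) : Th.Comp → Th.Comp → ℂ
  | .gauge a μ, .gauge b ν =>
      if a = b then
        -((p μ * p ν : ℝ) : ℂ) * Complex.I / (((msq p - ξ * Th.mass a ^ 2) ^ 2 : ℝ) : ℂ)
      else 0
  | .goldstone a _, .goldstone b _ =>
      if a = b then
        ((Th.mass a ^ 2 : ℝ) : ℂ) * Complex.I / (((msq p - ξ * Th.mass a ^ 2) ^ 2 : ℝ) : ℂ)
      else 0
  | _, _ => 0

/-- An external leg: incoming momentum, and a wave function (polarization vector, spinor, ...),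
which is either bosonic or fermionic. The momentum need not be on-shell. -/
structure Leg where
  mom : Momentum
  wave : Th.Comp → ℂ
  odd : Bool
  wave_parity : ∀ c, Th.parity c ≠ odd → wave c = 0

/-- A leg is a *physical, on-shell* particle: it has no Goldstone component, a gauge boson in
it is on its mass shell with polarization `ε·p = 0`, and the wave function of the remaining fields
solves the free field equation. -/
structure Leg.IsPhysical [Fintype M] {Th : FeynmanRules G M} (x : Th.Leg) : Prop where
  goldstone : ∀ a h, x.wave (.goldstone a h) = 0
  onShell : ∀ a μ, x.wave (.gauge a μ) ≠ 0 → msq x.mom = Th.mass a ^ 2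
  transverse : ∀ a, ∑ μ, ((metric μ μ * x.mom μ : ℝ) : ℂ) * x.wave (.gauge a μ) = 0
  matter : (Th.kin x.mom).mulVec (fun i => x.wave (.matter i)) = 0

open Classical in
/-- An amputated leg carrying the field component `c` and incoming momentum `k`, not
necessarily on-shell. -/
def amputatedLeg (c : Th.Comp) (k : Momentum) : Th.Leg where
  mom := k
  wave c' := if c' = c then 1 else 0
  odd := Th.parity c
  wave_parity c' h := if_neg fun e => h (by rw [e])

end FeynmanRules

/-! ### Tree diagrams -/

section Diagrams

variable {E : Type*} [Fintype E] [LinearOrder E]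

/-- `v` is a partition of the set of external legs into nonempty blocks. -/
def IsPartition (v : Finset (Finset E)) : Prop := ∅ ∉ v ∧ ∀ e, ∃! A, A ∈ v ∧ e ∈ A

/-- Tree-level Feynman topologies with external legs `E`, i.e. trees whose leaves are `E` and whose
other nodes (the vertices of the diagram) have at least three lines. Removing a vertex
disconnects the tree, so a vertex is recorded as the partition `v` of `E` into the sets of
legs that lie behind its lines; a block `A ∈ v` is the half-line that starts at `v` towards the legs
`A`. A finite set `T` of such vertices is a tree diagram if

* there is a vertex, and every vertex has at least three lines;
* a half-line `A` with a single leg is an external line, every other one is joined to the opposite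
  half-line `Aᶜ` of another vertex;
* two different vertices `v`, `w` are separated by the half-line `A` of `v` towards `w` and the
  half-line `B` of `w` towards `v`: every leg lies in `A` or in `B`. -/
structure IsTreeDiagram (T : Finset (Finset (Finset E))) : Prop where
  nonempty : T.Nonempty
  partition : ∀ v ∈ T, IsPartition v
  three_le : ∀ v ∈ T, 3 ≤ v.card
  joined : ∀ v ∈ T, ∀ A ∈ v, 2 ≤ A.card → ∃ w ∈ T, Aᶜ ∈ w
  separated : ∀ v ∈ T, ∀ w ∈ T, v ≠ w → ∃ A ∈ v, ∃ B ∈ w, A ∪ B = Finset.univ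

variable (E) in
open Classical in
/-- The finite set of all tree diagrams with external legs `E`. -/
def treeDiagrams : Finset (Finset (Finset (Finset E))) :=
  Finset.univ.filter IsTreeDiagram

/-- The half-lines of a diagram. -/
abbrev HalfLine (T : Finset (Finset (Finset E))) : Type _ := {A : Finset E // A ∈ T.biUnion id}

/-- `T` has an internal line that separates the legs `S` from the legs `Sᶜ`. -/
def HasLine (T : Finset (Finset (Finset E))) (S : Finset E) : Prop :=
  (∃ v ∈ T, S ∈ v) ∧ ∃ w ∈ T, Sᶜ ∈ w

variable (E) in
/-- The ways to distribute the external legs on two subamplitudes `S`, `Sᶜ` with at least two legs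
each. To list every unordered pair `{S, Sᶜ}` once, `S` is the one that contains the first leg. -/
def splittings : Finset (Finset E) :=
  Finset.univ.filter fun S => 2 ≤ S.card ∧ 2 ≤ Sᶜ.card ∧ S.min < Sᶜ.min

/-- The sign of the permutation of the fermionic legs that brings them from their
order in `E` to the order given by the list of disjoint sets. -/
def shuffleSign (odd : E → Bool) : List (Finset E) → ℂ
  | [] => 1
  | A :: l => (-1) ^ (l.map fun B =>
      ((A ×ˢ B).filter fun x => odd x.1 ∧ odd x.2 ∧ x.2 < x.1).card).sum * shuffleSign odd l

/-- The legs of the subamplitude of `S`: those in `S`, and one more leg `⊥`. Here every leg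
outside of `S` is sent to `⊥`. -/
def contractLegs (S : Finset E) (e : E) : WithBot {e // e ∈ S} :=
  if h : e ∈ S then ((⟨e, h⟩ : {e // e ∈ S}) : WithBot {e // e ∈ S}) else ⊥

/-- The vertices of a diagram with legs `S ∪ {⊥}`, seen as vertices of a diagram in which the legs
`Sᶜ` are attached to `⊥`. -/
def extendDiagram (S : Finset E) (T : Finset (Finset (Finset (WithBot {e // e ∈ S})))) :
    Finset (Finset (Finset E)) :=
  T.image fun v => v.image fun A => Finset.univ.filter fun e => contractLegs S e ∈ A

/-- Join a diagram with legs `S ∪ {⊥}` and a diagram with legs `Sᶜ ∪ {⊥}` at their legs `⊥`. -/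
def joinDiagrams (S : Finset E)
    (T : Finset (Finset (Finset (WithBot {e // e ∈ S}))) ×
      Finset (Finset (Finset (WithBot {e // e ∈ Sᶜ})))) : Finset (Finset (Finset E)) :=
  extendDiagram S T.1 ∪ extendDiagram Sᶜ T.2

end Diagrams

/-! ### Amplitudes -/

namespace FeynmanRules

variable {G M : Type*} [Fintype G] [Fintype M] [DecidableEq M] (Th : FeynmanRules G M)
variable {E : Type*} [Fintype E] [LinearOrder E]

/-- The sum of the incoming momenta of the legs in `A`; by momentum conservation the momentum that
enters a vertex through its half-line `A`. -/
def momentum {Th : FeynmanRules G M} (legs : E → Th.Leg) (A : Finset E) : Momentum :=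
  ∑ e ∈ A, (legs e).mom

/-- The value of a vertex `v` of the diagram `T` if the half-lines carry the components `f`. -/
def vertexFactor (legs : E → Th.Leg) (T : Finset (Finset (Finset E))) (f : HalfLine T → Th.Comp)
    (v : Finset (Finset E)) : ℂ :=
  let l : List (HalfLine T) := (Finset.univ.filter fun h : HalfLine T => h.1 ∈ v).toList
  shuffleSign (fun e => (legs e).odd) (l.map fun h => h.1) *
    Th.vertex (l.map fun h => (f h, momentum legs h.1))

/-- The value of the diagram `T` for given field components on all half-lines: the product of the
vertices, of the propagators of the internal lines `{A, Aᶜ}`, and of the wave functions of the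
external lines. The factors `shuffleSign` of vertices and propagators combine to the usual relative
sign of Feynman diagrams with fermions; the value does not depend on the order of the lines at a
vertex or on the orientation of the internal lines. -/
def diagramTerm (ξ : ℝ) (legs : E → Th.Leg) (T : Finset (Finset (Finset E)))
    (f : HalfLine T → Th.Comp) : ℂ :=
  (∏ v ∈ T, Th.vertexFactor legs T f v) *
  (∏ x : HalfLine T × HalfLine T with x.2.1 = x.1.1ᶜ ∧ x.1.1.min < x.2.1.min,
    shuffleSign (fun e => (legs e).odd) [x.2.1, x.1.1] *
      Th.propagator ξ (momentum legs x.1.1) (f x.1) (f x.2)) *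
  (∏ x : E × HalfLine T with x.2.1 = {x.1}, (legs x.1).wave (f x.2))

open Classical in
/-- The (amputated) tree-level amplitude in `R_ξ` gauge: the sum over all tree diagrams and over
the field components on their lines. -/
def amplitude (ξ : ℝ) (legs : E → Th.Leg) : ℂ :=
  ∑ T ∈ treeDiagrams E, ∑ f : HalfLine T → Th.Comp, Th.diagramTerm ξ legs T f

/-- The legs in `S` together with one further leg `x` at `⊥`. -/
def subLegs {Th : FeynmanRules G M} (legs : E → Th.Leg) (S : Finset E) (x : Th.Leg) :
    WithBot {e // e ∈ S} → Th.Leg :=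
  WithBot.recBotCoe x fun e => legs e.1

/-- The complete subamplitude with the external particles `S` and one more, amputated leg with
field component `c`, whose incoming momentum `-∑_{e ∈ S} p_e` is fixed by momentum conservation and
is off-shell. For a gauge boson component `c = W_a^μ` this is `𝓜_μ`, with lower index. -/
def subAmplitude (ξ : ℝ) (legs : E → Th.Leg) (S : Finset E) (c : Th.Comp) : ℂ :=
  Th.amplitude ξ (subLegs legs S (Th.amputatedLeg c (-momentum legs S)))

/-- The Ward identity with one unphysical gauge boson for the external particles `S`:
`-i k^μ 𝓜_μ(S + W_a(k)) = m_a 𝓜(S + φ_a(k))` for every gauge boson `a`,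
with incoming `k`. For massless gauge bosons there is no Goldstone boson and the right-hand side is
zero. -/
def WardIdentity (ξ : ℝ) (legs : E → Th.Leg) (S : Finset E) : Prop :=
  ∀ a : G,
    -Complex.I * ∑ μ, (((-momentum legs S) μ : ℝ) : ℂ) * Th.subAmplitude ξ legs S (.gauge a μ) =
      if h : Th.mass a ≠ 0 then
        (Th.mass a : ℂ) * Th.subAmplitude ξ legs S (.goldstone a h)
      else 0

/-- The Ward identities with one unphysical gauge boson hold for all proper subamplitudes, i.e. for
all subamplitudes that an internal line of a diagram can split off. -/
def SubWardIdentities (ξ : ℝ) (legs : E → Th.Leg) : Prop :=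
  ∀ S : Finset E, 2 ≤ S.card → 2 ≤ Sᶜ.card → Th.WardIdentity ξ legs S

/-- No internal line is at a pole of a propagator. -/
def NonSingular (ξ : ℝ) (legs : E → Th.Leg) : Prop :=
  ∀ S : Finset E, 2 ≤ S.card → 2 ≤ Sᶜ.card →
    (∀ a, msq (momentum legs S) ≠ Th.mass a ^ 2 ∧ msq (momentum legs S) ≠ ξ * Th.mass a ^ 2) ∧
    (Th.kin (momentum legs S)).det ≠ 0

/-- The sum over all ways to distribute the external particles on two complete subamplitudes that
are joined by one unphysical propagator. -/
def unphysicalExchange (ξ : ℝ) (legs : E → Th.Leg) : ℂ :=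
  ∑ S ∈ splittings E, shuffleSign (fun e => (legs e).odd) [S, Sᶜ] *
    ∑ c, ∑ c', Th.subAmplitude ξ legs S c *
      Th.unphysicalPropagator ξ (momentum legs S) c c' * Th.subAmplitude ξ legs Sᶜ c'

end FeynmanRules

end RxiGauge

end

/-! A tree diagram depends on ξ only through the propagators of its internal lines. The product rule
marks one line S | Sᶜ and replaces its propagator by its ξ-derivative. Since (1-ξ)/(p²-ξm²) has
derivative -(p²-m²)/(p²-ξm²)², the physical pole cancels and the unphysical propagator D' remains
(`hasDerivAt_propagator`). After the sums over diagrams and marked lines are exchanged,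
factorization rests on two facts: diagrams with the line S are pairs of diagrams with legs S ∪ {⊥}
and Sᶜ ∪ {⊥} (`bijOn_joinDiagrams`), and the value of a joined diagram is the product of the two
values up to a sign (`markedTerm_join`).

For the bijection, sets of legs are pulled back along the contraction E → S ∪ {⊥}. In a tree with
the line S every vertex has a block containing Sᶜ or a block containing S, never both, because two
blocks out of at least three cannot cover E. This decides the side of the vertex.

For the fermion signs, a nonzero term forces every label to have the parity of the legs behind its
half-line (`consistent_of_conserved`), so values do not depend on the order of lines at a vertex or
on the orientation of lines. D' joins only bosonic components, hence S and Sᶜ are both even.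
Replacing ⊥ by the block Sᶜ costs one sign for each leg it crosses; along the tree these signs
cancel except at the external legs (`prod_halfLines_mul_prod_lines`), which leaves the reordering
sign of S against Sᶜ.

For every gauge boson D' contracts to a common factor times the Goldstone product m² φ φ' minus
(P·W)(P·W'). The Ward identities of the two sides, with k = -P and k = P, equate these two products.
For finite changes of ξ a vanishing derivative gives only local constancy, as the poles cut the
nonsingular set into pieces; the amplitude is rational in ξ, so one constant serves all pieces. -/

open scoped BigOperators
set_option linter.unusedSectionVars false
noncomputable section

namespace RxiGauge

/-! ### Partitions and tree diagrams -/

section Trees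

variable {E : Type*} [Fintype E] [LinearOrder E]

namespace IsPartition

variable {v : Finset (Finset E)} (hv : IsPartition v)
include hv

theorem eq_of_mem {A B : Finset E} {e : E} (hA : A ∈ v) (hB : B ∈ v) (heA : e ∈ A)
    (heB : e ∈ B) : A = B :=
  (hv.2 e).unique ⟨hA, heA⟩ ⟨hB, heB⟩

theorem nonempty {A : Finset E} (hA : A ∈ v) : A.Nonempty :=
  Finset.nonempty_iff_ne_empty.2 fun h => hv.1 (h ▸ hA)

theorem exists_mem (e : E) : ∃ A ∈ v, e ∈ A := (hv.2 e).exists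

theorem disjoint {A B : Finset E} (hA : A ∈ v) (hB : B ∈ v) (h : A ≠ B) : Disjoint A B :=
  Finset.disjoint_left.2 fun _ heA heB => h (hv.eq_of_mem hA hB heA heB)

theorem biUnion_eq_univ : v.biUnion id = Finset.univ :=
  Finset.eq_univ_of_forall fun e => by
    obtain ⟨A, hA, he⟩ := hv.exists_mem e
    exact Finset.mem_biUnion.2 ⟨A, hA, he⟩

/-- A third block is nonempty and disjoint from both. Most exclusions below come down to this. -/
theorem union_ne_univ (h3 : 3 ≤ v.card) {A B : Finset E} (hA : A ∈ v) (hB : B ∈ v) :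
    A ∪ B ≠ Finset.univ := by
  intro h
  have hlt : ({A, B} : Finset (Finset E)).card < v.card :=
    lt_of_le_of_lt Finset.card_le_two (by omega)
  obtain ⟨C, hC, hCAB⟩ := Finset.exists_mem_notMem_of_card_lt_card hlt
  obtain ⟨e, he⟩ := hv.nonempty hC
  have : e ∈ A ∪ B := h ▸ Finset.mem_univ e
  simp only [Finset.mem_insert, Finset.mem_singleton, not_or] at hCAB
  rcases Finset.mem_union.1 this with h' | h'
  · exact hCAB.1 (hv.eq_of_mem hC hA he h')
  · exact hCAB.2 (hv.eq_of_mem hC hB he h')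

theorem two_le_card_compl (h3 : 3 ≤ v.card) {A : Finset E} (hA : A ∈ v) : 2 ≤ Aᶜ.card := by
  have h2 : 1 < (v.erase A).card := by
    rw [Finset.card_erase_of_mem hA]; omega
  obtain ⟨B, hB, C, hC, hBC⟩ := Finset.one_lt_card.1 h2
  rw [Finset.mem_erase] at hB hC
  obtain ⟨b, hb⟩ := hv.nonempty hB.2
  obtain ⟨c, hc⟩ := hv.nonempty hC.2
  refine Finset.one_lt_card.2 ⟨b, ?_, c, ?_, ?_⟩
  · exact Finset.mem_compl.2 fun h => hB.1 (hv.eq_of_mem hB.2 hA hb h)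
  · exact Finset.mem_compl.2 fun h => hC.1 (hv.eq_of_mem hC.2 hA hc h)
  · rintro rfl
    exact hBC (hv.eq_of_mem hB.2 hC.2 hb hc)

theorem erase_biUnion {A : Finset E} (hA : A ∈ v) : (v.erase A).biUnion id = Aᶜ := by
  ext e
  simp only [Finset.mem_biUnion, Finset.mem_erase, id, Finset.mem_compl]
  constructor
  · rintro ⟨B, ⟨hBA, hB⟩, he⟩ h
    exact hBA (hv.eq_of_mem hB hA he h)
  · intro he
    obtain ⟨B, hB, heB⟩ := hv.exists_mem e
    exact ⟨B, ⟨fun h => he (h ▸ heB), hB⟩, heB⟩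

end IsPartition

namespace IsTreeDiagram

variable {T : Finset (Finset (Finset E))} (hT : IsTreeDiagram T)
include hT

/-- If A lies in two different vertices, one of the two separating blocks is A itself, since a leg
of A is covered by one of them. Then A and the other block lie in one vertex and cover all legs. -/
theorem vertex_unique {v w : Finset (Finset E)} (hv : v ∈ T) (hw : w ∈ T) {A : Finset E}
    (hAv : A ∈ v) (hAw : A ∈ w) : v = w := by
  by_contra hne
  obtain ⟨B, hB, C, hC, hBC⟩ := hT.separated v hv w hw hne
  have pv := hT.partition v hv
  have pw := hT.partition w hw
  by_cases hAB : A = B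
  · subst hAB
    exact pw.union_ne_univ (hT.three_le w hw) hAw hC hBC
  · have hAC : A = C := by
      obtain ⟨e, he⟩ := pv.nonempty hAv
      have heC : e ∈ C := by
        rcases Finset.mem_union.1 (hBC ▸ Finset.mem_univ e : e ∈ B ∪ C) with h | h
        · exact absurd (pv.eq_of_mem hAv hB he h) hAB
        · exact h
      exact pw.eq_of_mem hAw hC he heC
    subst hAC
    exact pv.union_ne_univ (hT.three_le v hv) hB hAv hBC

theorem exists_singleton_mem (e : E) : ∃ v ∈ T, {e} ∈ v := by
  have key : ∀ n : ℕ, ∀ v ∈ T, ∀ A ∈ v, e ∈ A → A.card ≤ n → ∃ v ∈ T, {e} ∈ v := by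
    intro n
    induction n with
    | zero =>
      intro v _ A _ heA hc
      exact absurd (Finset.card_pos.2 ⟨e, heA⟩) (by omega)
    | succ n ih =>
      intro v hv A hA heA hc
      by_cases h1 : A.card ≤ 1
      · have : A = {e} :=
          Finset.eq_singleton_iff_unique_mem.2 ⟨heA, fun x hx => Finset.card_le_one.1 h1 x hx e heA⟩
        exact ⟨v, hv, this ▸ hA⟩
      -- Cross the line A: at the vertex on its far side the block of `e` is a proper subset of A,
      -- so the descent ends at a single leg.
      · obtain ⟨w, hw, hAw⟩ := hT.joined v hv A hA (by omega)
        have pw := hT.partition w hw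
        obtain ⟨B, hB, heB⟩ := pw.exists_mem e
        have hBA : B ≠ Aᶜ := fun h => Finset.mem_compl.1 (h ▸ heB) heA
        have hsub : B ⊆ A := by
          have := (pw.disjoint hB hAw hBA)
          intro x hx
          by_contra hxA
          exact Finset.disjoint_left.1 this hx (Finset.mem_compl.2 hxA)
        have hne : B ≠ A := by
          rintro rfl
          exact pw.union_ne_univ (hT.three_le w hw) hB hAw (by simp)
        have := Finset.card_lt_card (hsub.ssubset_of_ne hne)
        exact ih w hw B hB heB (by omega)
  obtain ⟨v, hv⟩ := hT.nonempty
  obtain ⟨A, hA, he⟩ := (hT.partition v hv).exists_mem e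
  exact key _ v hv A hA he le_rfl

theorem two_le_card_compl {A : Finset E} (hA : A ∈ T.biUnion id) : 2 ≤ Aᶜ.card := by
  obtain ⟨v, hv, hAv⟩ := Finset.mem_biUnion.1 hA
  exact (hT.partition v hv).two_le_card_compl (hT.three_le v hv) hAv

theorem halfLine_nonempty {A : Finset E} (hA : A ∈ T.biUnion id) : A.Nonempty := by
  obtain ⟨v, hv, hAv⟩ := Finset.mem_biUnion.1 hA
  exact (hT.partition v hv).nonempty hAv

theorem compl_mem {A : Finset E} (hA : A ∈ T.biUnion id) (h2 : 2 ≤ A.card) :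
    Aᶜ ∈ T.biUnion id := by
  obtain ⟨v, hv, hAv⟩ := Finset.mem_biUnion.1 hA
  obtain ⟨w, hw, h⟩ := hT.joined v hv A hAv h2
  exact Finset.mem_biUnion.2 ⟨w, hw, h⟩

theorem singleton_mem (e : E) : {e} ∈ T.biUnion id := by
  obtain ⟨v, hv, h⟩ := hT.exists_singleton_mem e
  exact Finset.mem_biUnion.2 ⟨v, hv, h⟩

theorem biUnion_nonempty : (T.biUnion id).Nonempty := by
  obtain ⟨v, hv⟩ := hT.nonempty
  have h3 := hT.three_le v hv
  obtain ⟨A, hA⟩ := Finset.card_pos.1 (by omega : 0 < v.card)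
  exact ⟨A, Finset.mem_biUnion.2 ⟨v, hv, hA⟩⟩

/-- In a tree diagram with a line `S`, a vertex lies on one of the two sides of the line. -/
theorem exists_superset {S : Finset E} {v w : Finset (Finset E)} (hv : v ∈ T) (hw : w ∈ T)
    (hS : S ∈ w) : ∃ A ∈ v, S ⊆ A ∨ Sᶜ ⊆ A := by
  by_cases hvw : v = w
  · exact ⟨S, hvw ▸ hS, Or.inl subset_rfl⟩
  obtain ⟨A, hA, B, hB, hAB⟩ := hT.separated v hv w hw hvw
  have cover : ∀ x, x ∉ B → x ∈ A := fun x hx =>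
    (Finset.mem_union.1 (hAB ▸ Finset.mem_univ x : x ∈ A ∪ B)).resolve_right hx
  refine ⟨A, hA, ?_⟩
  by_cases hBS : B = S
  · exact Or.inr fun x hx => cover x (hBS ▸ Finset.mem_compl.1 hx)
  · exact Or.inl fun x hx => cover x fun hxB =>
      hBS ((hT.partition w hw).eq_of_mem hB hS hxB hx)

end IsTreeDiagram

end Trees

/-! ### Contracting the legs outside of a set -/

section Pull

variable {E : Type*} [Fintype E] [LinearOrder E] {S : Finset E}

theorem contractLegs_of_mem {e : E} (h : e ∈ S) :
    contractLegs S e = ((⟨e, h⟩ : {e // e ∈ S}) : WithBot {e // e ∈ S}) := dif_pos h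

theorem contractLegs_of_notMem {e : E} (h : e ∉ S) : contractLegs S e = ⊥ := dif_neg h

theorem contractLegs_eq_bot {e : E} : contractLegs S e = ⊥ ↔ e ∉ S := by
  constructor
  · intro h he
    rw [contractLegs_of_mem he] at h
    exact WithBot.coe_ne_bot h
  · exact contractLegs_of_notMem

theorem contractLegs_eq_coe {e : E} {s : {e // e ∈ S}} :
    contractLegs S e = (s : WithBot {e // e ∈ S}) ↔ e = s.1 := by
  constructor
  · intro h
    by_cases he : e ∈ S
    · rw [contractLegs_of_mem he] at h
      rw [← WithBot.coe_injective h]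
    · rw [contractLegs_of_notMem he] at h
      exact absurd h.symm WithBot.coe_ne_bot
  · rintro rfl
    exact contractLegs_of_mem s.2

theorem contractLegs_surjective (hS : Sᶜ.Nonempty) : Function.Surjective (contractLegs S) := by
  intro x
  induction x with
  | bot =>
    obtain ⟨e, he⟩ := hS
    exact ⟨e, contractLegs_of_notMem (Finset.mem_compl.1 he)⟩
  | coe s => exact ⟨s.1, contractLegs_of_mem s.2⟩

/-- The decidable equality that the order on the legs of a subamplitude provides. -/
instance subLegsDecidableEq {E : Type*} [LinearOrder E] {S : Finset E} :
    DecidableEq (WithBot {e // e ∈ S}) := LinearOrder.toDecidableEq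

variable (S) in
/-- The legs in `E` that are attached to the legs `A` of the subamplitude of `S`. -/
def pull (A : Finset (WithBot {e // e ∈ S})) : Finset E :=
  Finset.univ.filter fun e => contractLegs S e ∈ A

theorem mem_pull {A : Finset (WithBot {e // e ∈ S})} {e : E} :
    e ∈ pull S A ↔ contractLegs S e ∈ A := by
  simp [pull]

theorem pull_compl (A : Finset (WithBot {e // e ∈ S})) : pull S Aᶜ = (pull S A)ᶜ := by
  ext e; simp [mem_pull]

theorem pull_union (A B : Finset (WithBot {e // e ∈ S})) :
    pull S (A ∪ B) = pull S A ∪ pull S B := by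
  ext e; simp [mem_pull]

theorem pull_univ : pull S Finset.univ = Finset.univ := by
  ext e; simp [mem_pull]

theorem pull_empty : pull S ∅ = ∅ := by
  ext e; simp [mem_pull]

theorem pull_bot : pull S {⊥} = Sᶜ := by
  ext e; simp [mem_pull, contractLegs_eq_bot]

theorem pull_coe (s : {e // e ∈ S}) : pull S {(s : WithBot {e // e ∈ S})} = {s.1} := by
  ext e; simp [mem_pull, contractLegs_eq_coe]

theorem compl_subset_pull {A : Finset (WithBot {e // e ∈ S})} (h : ⊥ ∈ A) : Sᶜ ⊆ pull S A := by
  intro e he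
  rw [mem_pull, contractLegs_of_notMem (Finset.mem_compl.1 he)]
  exact h

theorem pull_subset {A : Finset (WithBot {e // e ∈ S})} (h : ⊥ ∉ A) : pull S A ⊆ S := by
  intro e he
  by_contra hS
  rw [mem_pull, contractLegs_of_notMem hS] at he
  exact h he

theorem pull_injective (hS : Sᶜ.Nonempty) : Function.Injective (pull S) := by
  intro A B h
  ext x
  obtain ⟨e, rfl⟩ := contractLegs_surjective hS x
  rw [← mem_pull, ← mem_pull, h]

/-- The condition says that A is a union of fibres of the contraction: the only fibre that can have
several legs is Sᶜ, and A contains or avoids it. -/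
theorem exists_pull_eq {A : Finset E} (h : Sᶜ ⊆ A ∨ A ⊆ S) : ∃ B, pull S B = A := by
  refine ⟨A.image (contractLegs S), ?_⟩
  ext e
  rw [mem_pull, Finset.mem_image]
  constructor
  · rintro ⟨x, hx, hxe⟩
    by_cases he : e ∈ S
    · rw [contractLegs_of_mem he, contractLegs_eq_coe] at hxe
      exact (show x = e from hxe) ▸ hx
    · rcases h with h | h
      · exact h (Finset.mem_compl.2 he)
      · rw [contractLegs_of_notMem he, contractLegs_eq_bot] at hxe
        exact absurd (h hx) hxe
  · exact fun he => ⟨e, he, rfl⟩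

theorem card_le_card_pull (hS : Sᶜ.Nonempty) (A : Finset (WithBot {e // e ∈ S})) :
    A.card ≤ (pull S A).card := by
  have : (pull S A).image (contractLegs S) = A := by
    ext x
    obtain ⟨e, rfl⟩ := contractLegs_surjective hS x
    simp only [Finset.mem_image, mem_pull]
    exact ⟨fun ⟨y, hy, h⟩ => h ▸ hy, fun h => ⟨e, h, rfl⟩⟩
  calc A.card = ((pull S A).image (contractLegs S)).card := by rw [this]
    _ ≤ _ := Finset.card_image_le

theorem pull_union_eq_univ (hS : Sᶜ.Nonempty) {A B : Finset (WithBot {e // e ∈ S})} :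
    pull S A ∪ pull S B = Finset.univ ↔ A ∪ B = Finset.univ := by
  rw [← pull_union, ← pull_univ (S := S), (pull_injective hS).eq_iff]

theorem isPartition_image_pull (hS : Sᶜ.Nonempty) {v : Finset (Finset (WithBot {e // e ∈ S}))} :
    IsPartition (v.image (pull S)) ↔ IsPartition v := by
  unfold IsPartition
  refine and_congr ?_ ?_
  · rw [not_iff_not, ← pull_empty (S := S), Finset.mem_image]
    exact ⟨fun ⟨A, hA, h⟩ => pull_injective hS h ▸ hA, fun h => ⟨∅, h, rfl⟩⟩
  · rw [(contractLegs_surjective hS).forall]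
    refine forall_congr' fun e => ?_
    constructor
    · rintro ⟨A, ⟨hA, heA⟩, huniq⟩
      obtain ⟨B, hB, rfl⟩ := Finset.mem_image.1 hA
      refine ⟨B, ⟨hB, mem_pull.1 heA⟩, fun C hC => pull_injective hS ?_⟩
      exact huniq _ ⟨Finset.mem_image_of_mem _ hC.1, mem_pull.2 hC.2⟩
    · rintro ⟨B, ⟨hB, heB⟩, huniq⟩
      refine ⟨pull S B, ⟨Finset.mem_image_of_mem _ hB, mem_pull.2 heB⟩, ?_⟩
      rintro A ⟨hA, heA⟩
      obtain ⟨C, hC, rfl⟩ := Finset.mem_image.1 hA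
      rw [huniq C ⟨hC, mem_pull.1 heA⟩]

theorem image_pull_injective (hS : Sᶜ.Nonempty) :
    Function.Injective fun v : Finset (Finset (WithBot {e // e ∈ S})) => v.image (pull S) :=
  Finset.image_injective (pull_injective hS)

theorem extendDiagram_eq (T : Finset (Finset (Finset (WithBot {e // e ∈ S})))) :
    extendDiagram S T = T.image fun v => v.image (pull S) := rfl

theorem mem_extendDiagram {T : Finset (Finset (Finset (WithBot {e // e ∈ S})))}
    {v : Finset (Finset E)} : v ∈ extendDiagram S T ↔ ∃ w ∈ T, w.image (pull S) = v := by
  rw [extendDiagram_eq, Finset.mem_image]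

theorem extendDiagram_injective (hS : Sᶜ.Nonempty) : Function.Injective (extendDiagram S) := by
  intro T T' h
  rw [extendDiagram_eq, extendDiagram_eq] at h
  exact Finset.image_injective (image_pull_injective hS) h

theorem exists_compl_subset {T : Finset (Finset (Finset (WithBot {e // e ∈ S})))}
    (hT : IsTreeDiagram T) {v : Finset (Finset E)} (hv : v ∈ extendDiagram S T) :
    ∃ A ∈ v, Sᶜ ⊆ A := by
  obtain ⟨w, hw, rfl⟩ := mem_extendDiagram.1 hv
  obtain ⟨A, hA, hb⟩ := (hT.partition w hw).exists_mem ⊥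
  exact ⟨_, Finset.mem_image_of_mem _ hA, compl_subset_pull hb⟩

/-- Attaching the legs outside of `S` preserves the vertices of a diagram. -/
theorem extendDiagram_partition (hS : Sᶜ.Nonempty)
    {T : Finset (Finset (Finset (WithBot {e // e ∈ S})))}
    (hT : IsTreeDiagram T) {v : Finset (Finset E)} (hv : v ∈ extendDiagram S T) :
    IsPartition v ∧ 3 ≤ v.card := by
  obtain ⟨w, hw, rfl⟩ := mem_extendDiagram.1 hv
  refine ⟨(isPartition_image_pull hS).2 (hT.partition w hw), ?_⟩
  rw [Finset.card_image_of_injective _ (pull_injective hS)]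
  exact hT.three_le w hw

theorem compl_mem_extendDiagram {T : Finset (Finset (Finset (WithBot {e // e ∈ S})))}
    (hT : IsTreeDiagram T) : ∃ v ∈ extendDiagram S T, Sᶜ ∈ v := by
  obtain ⟨w, hw, hb⟩ := hT.exists_singleton_mem ⊥
  refine ⟨_, mem_extendDiagram.2 ⟨w, hw, rfl⟩, ?_⟩
  rw [← pull_bot]
  exact Finset.mem_image_of_mem _ hb

theorem extendDiagram_joined {T : Finset (Finset (Finset (WithBot {e // e ∈ S})))}
    (hT : IsTreeDiagram T) {v : Finset (Finset E)} (hv : v ∈ extendDiagram S T)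
    {A : Finset E} (hA : A ∈ v) (h2 : 2 ≤ A.card) (hne : A ≠ Sᶜ) :
    ∃ w ∈ extendDiagram S T, Aᶜ ∈ w := by
  obtain ⟨w, hw, rfl⟩ := mem_extendDiagram.1 hv
  obtain ⟨B, hB, rfl⟩ := Finset.mem_image.1 hA
  -- A single leg B would pull back to Sᶜ, excluded by `hne`, or to a single leg, excluded by `h2`.
  have hB2 : 2 ≤ B.card := by
    by_contra hlt
    have h0 := Finset.card_pos.2 ((hT.partition w hw).nonempty hB)
    obtain ⟨x, rfl⟩ := Finset.card_eq_one.1 (by omega : B.card = 1)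
    induction x with
    | bot => exact hne pull_bot
    | coe s => rw [pull_coe, Finset.card_singleton] at h2; omega
  obtain ⟨u, hu, hBu⟩ := hT.joined w hw B hB hB2
  refine ⟨_, mem_extendDiagram.2 ⟨u, hu, rfl⟩, ?_⟩
  rw [← pull_compl]
  exact Finset.mem_image_of_mem _ hBu

theorem extendDiagram_separated {T : Finset (Finset (Finset (WithBot {e // e ∈ S})))}
    (hT : IsTreeDiagram T) {v w : Finset (Finset E)} (hv : v ∈ extendDiagram S T)
    (hw : w ∈ extendDiagram S T) (hne : v ≠ w) : ∃ A ∈ v, ∃ B ∈ w, A ∪ B = Finset.univ := by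
  obtain ⟨v', hv', rfl⟩ := mem_extendDiagram.1 hv
  obtain ⟨w', hw', rfl⟩ := mem_extendDiagram.1 hw
  obtain ⟨A, hA, B, hB, hAB⟩ := hT.separated v' hv' w' hw' fun h => hne (h ▸ rfl)
  refine ⟨_, Finset.mem_image_of_mem _ hA, _, Finset.mem_image_of_mem _ hB, ?_⟩
  rw [← pull_union]
  exact (congrArg (pull S) hAB).trans pull_univ

theorem union_eq_univ_of_subset {A B : Finset E} (hA : Sᶜ ⊆ A) (hB : S ⊆ B) :
    A ∪ B = Finset.univ := by
  ext x
  simp only [Finset.mem_union, Finset.mem_univ, iff_true]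
  by_cases hx : x ∈ S
  · exact Or.inr (hB hx)
  · exact Or.inl (hA (Finset.mem_compl.2 hx))

theorem isTreeDiagram_join (h1 : S.Nonempty) (h2 : Sᶜ.Nonempty)
    {T₁ : Finset (Finset (Finset (WithBot {e // e ∈ S})))}
    {T₂ : Finset (Finset (Finset (WithBot {e // e ∈ Sᶜ})))}
    (hT₁ : IsTreeDiagram T₁) (hT₂ : IsTreeDiagram T₂) :
    IsTreeDiagram (joinDiagrams S (T₁, T₂)) := by
  have h1' : Sᶜᶜ.Nonempty := by rwa [compl_compl]
  have mem : ∀ v, v ∈ joinDiagrams S (T₁, T₂) ↔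
      v ∈ extendDiagram S T₁ ∨ v ∈ extendDiagram Sᶜ T₂ := fun v => Finset.mem_union
  have part : ∀ v ∈ joinDiagrams S (T₁, T₂), IsPartition v ∧ 3 ≤ v.card := fun v hv =>
    ((mem v).1 hv).elim (extendDiagram_partition h2 hT₁) (extendDiagram_partition h1' hT₂)
  have s₂ : ∀ v ∈ extendDiagram Sᶜ T₂, ∃ A ∈ v, S ⊆ A := fun v hv => by
    simpa using exists_compl_subset hT₂ hv
  have m₂ : ∃ v ∈ extendDiagram Sᶜ T₂, S ∈ v := by
    simpa using compl_mem_extendDiagram hT₂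
  refine ⟨?_, fun v hv => (part v hv).1, fun v hv => (part v hv).2, ?_, ?_⟩
  · obtain ⟨v, hv, -⟩ := compl_mem_extendDiagram hT₁
    exact ⟨v, (mem v).2 (Or.inl hv)⟩
  · intro v hv A hA hA2
    rcases (mem v).1 hv with hv | hv
    · by_cases hAS : A = Sᶜ
      · obtain ⟨w, hw, h⟩ := m₂
        exact ⟨w, (mem w).2 (Or.inr hw), by rwa [hAS, compl_compl]⟩
      · obtain ⟨w, hw, h⟩ := extendDiagram_joined hT₁ hv hA hA2 hAS
        exact ⟨w, (mem w).2 (Or.inl hw), h⟩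
    · by_cases hAS : A = Sᶜᶜ
      · obtain ⟨w, hw, h⟩ := compl_mem_extendDiagram hT₁
        exact ⟨w, (mem w).2 (Or.inl hw), by rwa [hAS, compl_compl]⟩
      · obtain ⟨w, hw, h⟩ := extendDiagram_joined hT₂ hv hA hA2 hAS
        exact ⟨w, (mem w).2 (Or.inr hw), h⟩
  · intro v hv w hw hne
    rcases (mem v).1 hv with hv | hv <;> rcases (mem w).1 hw with hw | hw
    · exact extendDiagram_separated hT₁ hv hw hne
    -- Vertices on opposite sides are separated by their blocks towards the cut, one containing Sᶜ
    -- and the other S.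
    · obtain ⟨A, hA, hSA⟩ := exists_compl_subset hT₁ hv
      obtain ⟨B, hB, hSB⟩ := s₂ w hw
      exact ⟨A, hA, B, hB, union_eq_univ_of_subset hSA hSB⟩
    · obtain ⟨A, hA, hSA⟩ := s₂ v hv
      obtain ⟨B, hB, hSB⟩ := exists_compl_subset hT₁ hw
      exact ⟨A, hA, B, hB, by rw [Finset.union_comm]; exact union_eq_univ_of_subset hSB hSA⟩
    · exact extendDiagram_separated hT₂ hv hw hne

theorem not_compl_subset_of_extendDiagram (h1 : S.Nonempty)
    {T₂ : Finset (Finset (Finset (WithBot {e // e ∈ Sᶜ})))} (hT₂ : IsTreeDiagram T₂)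
    {v : Finset (Finset E)} (hv : v ∈ extendDiagram Sᶜ T₂) : ¬ ∃ A ∈ v, Sᶜ ⊆ A := by
  rintro ⟨A, hA, hSA⟩
  have h1' : Sᶜᶜ.Nonempty := by rwa [compl_compl]
  obtain ⟨p, h3⟩ := extendDiagram_partition h1' hT₂ hv
  obtain ⟨B, hB, hSB⟩ := exists_compl_subset hT₂ hv
  rw [compl_compl] at hSB
  exact p.union_ne_univ h3 hA hB (union_eq_univ_of_subset hSA hSB)

theorem disjoint_extendDiagram (h1 : S.Nonempty)
    {T₁ : Finset (Finset (Finset (WithBot {e // e ∈ S})))}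
    {T₂ : Finset (Finset (Finset (WithBot {e // e ∈ Sᶜ})))}
    (hT₁ : IsTreeDiagram T₁) (hT₂ : IsTreeDiagram T₂) :
    Disjoint (extendDiagram S T₁) (extendDiagram Sᶜ T₂) :=
  Finset.disjoint_left.2 fun _ hv hv' =>
    not_compl_subset_of_extendDiagram h1 hT₂ hv' (exists_compl_subset hT₁ hv)

theorem mem_extendDiagram_iff_join (h1 : S.Nonempty)
    {T₁ : Finset (Finset (Finset (WithBot {e // e ∈ S})))}
    {T₂ : Finset (Finset (Finset (WithBot {e // e ∈ Sᶜ})))}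
    (hT₁ : IsTreeDiagram T₁) (hT₂ : IsTreeDiagram T₂) (v : Finset (Finset E)) :
    v ∈ extendDiagram S T₁ ↔ v ∈ joinDiagrams S (T₁, T₂) ∧ ∃ A ∈ v, Sᶜ ⊆ A := by
  constructor
  · exact fun hv => ⟨Finset.mem_union_left _ hv, exists_compl_subset hT₁ hv⟩
  · rintro ⟨hv, hA⟩
    exact (Finset.mem_union.1 hv).resolve_right fun h =>
      not_compl_subset_of_extendDiagram h1 hT₂ h hA

theorem mem_joinDiagrams
    (T₁ : Finset (Finset (Finset (WithBot {e // e ∈ S}))))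
    (T₂ : Finset (Finset (Finset (WithBot {e // e ∈ Sᶜ})))) (v : Finset (Finset E)) :
    v ∈ joinDiagrams S (T₁, T₂) ↔ v ∈ extendDiagram S T₁ ∨ v ∈ extendDiagram Sᶜ T₂ :=
  Finset.mem_union

theorem mem_extendDiagram_compl_iff_join (h2 : Sᶜ.Nonempty)
    {T₁ : Finset (Finset (Finset (WithBot {e // e ∈ S})))}
    {T₂ : Finset (Finset (Finset (WithBot {e // e ∈ Sᶜ})))}
    (hT₁ : IsTreeDiagram T₁) (hT₂ : IsTreeDiagram T₂) (v : Finset (Finset E)) :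
    v ∈ extendDiagram Sᶜ T₂ ↔ v ∈ joinDiagrams S (T₁, T₂) ∧ ∃ A ∈ v, S ⊆ A := by
  constructor
  · exact fun hv => ⟨Finset.mem_union_right _ hv, by simpa using exists_compl_subset hT₂ hv⟩
  · rintro ⟨hv, B, hB, hSB⟩
    refine (Finset.mem_union.1 hv).resolve_left fun h => ?_
    obtain ⟨p, h3⟩ := extendDiagram_partition h2 hT₁ h
    obtain ⟨A, hA, hSA⟩ := exists_compl_subset hT₁ h
    exact p.union_ne_univ h3 hA hB (union_eq_univ_of_subset hSA hSB)

/-- Cutting T at the line S. A vertex with a block containing Sᶜ has all its other blocks inside S,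
so it is the pullback of a vertex of the contracted diagram. -/
theorem exists_extendDiagram_eq (h2 : Sᶜ.Nonempty) {T : Finset (Finset (Finset E))}
    (hT : IsTreeDiagram T) {w₀ : Finset (Finset E)} (hw₀ : w₀ ∈ T) (hSw₀ : Sᶜ ∈ w₀) :
    ∃ T₁ : Finset (Finset (Finset (WithBot {e // e ∈ S}))), IsTreeDiagram T₁ ∧
      ∀ v, v ∈ extendDiagram S T₁ ↔ v ∈ T ∧ ∃ A ∈ v, Sᶜ ⊆ A := by
  classical
  set T₁ : Finset (Finset (Finset (WithBot {e // e ∈ S}))) :=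
    Finset.univ.filter fun v => v.image (pull S) ∈ T with hT₁
  have mem : ∀ v, v ∈ T₁ ↔ v.image (pull S) ∈ T := fun v => by simp [hT₁]
  have lift : ∀ v ∈ T, (∃ A ∈ v, Sᶜ ⊆ A) → ∃ u ∈ T₁, u.image (pull S) = v := by
    rintro v hv ⟨A, hA, hSA⟩
    have p := hT.partition v hv
    have himg : (Finset.univ.filter fun B => pull S B ∈ v).image (pull S) = v := by
      ext C
      simp only [Finset.mem_image, Finset.mem_filter, Finset.mem_univ, true_and]
      constructor
      · rintro ⟨B, hB, rfl⟩
        exact hB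
      · intro hC
        obtain ⟨B, rfl⟩ : ∃ B, pull S B = C := by
          apply exists_pull_eq
          by_cases hCA : C = A
          · exact Or.inl (hCA ▸ hSA)
          · refine Or.inr fun x hx => ?_
            by_contra hxS
            exact hCA (p.eq_of_mem hC hA hx (hSA (Finset.mem_compl.2 hxS)))
        exact ⟨B, hC, rfl⟩
    exact ⟨_, (mem _).2 (himg.symm ▸ hv :), himg⟩
  have part : ∀ v ∈ T₁, IsPartition v := fun v hv =>
    (isPartition_image_pull h2).1 (hT.partition _ ((mem v).1 hv))
  have three : ∀ v ∈ T₁, 3 ≤ v.card := fun v hv => by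
    have := hT.three_le _ ((mem v).1 hv)
    rwa [Finset.card_image_of_injective _ (pull_injective h2)] at this
  have tree : IsTreeDiagram T₁ := by
    refine ⟨?_, part, three, ?_, ?_⟩
    · obtain ⟨u, hu, -⟩ := lift w₀ hw₀ ⟨_, hSw₀, subset_rfl⟩
      exact ⟨u, hu⟩
    · intro v hv B hB hB2
      obtain ⟨w, hw, hBw⟩ := hT.joined _ ((mem v).1 hv) (pull S B)
        (Finset.mem_image_of_mem _ hB) (hB2.trans (card_le_card_pull h2 B))
      have pw := hT.partition w hw
      rw [← pull_compl] at hBw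
      -- The neighbour `w` stays on this side of the cut. If ⊥ ∉ B, the opposite half-line contains
      -- Sᶜ. If ⊥ ∈ B and `w` had a block containing S, the opposite half-line would be S itself, so
      -- B = {⊥}, against `hB2`.
      have hside : ∃ A ∈ w, Sᶜ ⊆ A := by
        by_cases hbot : ⊥ ∈ B
        · obtain ⟨A, hA, h | h⟩ := hT.exists_superset hw hw₀ hSw₀
          · exact ⟨A, hA, h⟩
          · rw [compl_compl] at h
            obtain ⟨e, he⟩ := pw.nonempty hBw
            have hsub : pull S Bᶜ ⊆ S := pull_subset (by simpa using hbot)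
            have hAe : A = pull S Bᶜ := pw.eq_of_mem hA hBw (h (hsub he)) he
            have hBS : pull S B = pull S {⊥} := by
              rw [pull_bot, ← compl_inj_iff, ← pull_compl, compl_compl]
              exact subset_antisymm hsub (hAe ▸ h)
            rw [pull_injective h2 hBS, Finset.card_singleton] at hB2
            omega
        · exact ⟨_, hBw, compl_subset_pull (by simpa using hbot)⟩
      obtain ⟨u, hu, rfl⟩ := lift w hw hside
      obtain ⟨C, hC, hCB⟩ := Finset.mem_image.1 hBw
      exact ⟨u, hu, pull_injective h2 hCB ▸ hC⟩
    · intro v hv w hw hne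
      obtain ⟨A, hA, B, hB, hAB⟩ := hT.separated _ ((mem v).1 hv) _ ((mem w).1 hw)
        fun h => hne (image_pull_injective h2 h)
      obtain ⟨A, hA', rfl⟩ := Finset.mem_image.1 hA
      obtain ⟨B, hB', rfl⟩ := Finset.mem_image.1 hB
      exact ⟨A, hA', B, hB', (pull_union_eq_univ h2).1 hAB⟩
  refine ⟨T₁, tree, fun v => ⟨fun hv => ?_, fun hv => ?_⟩⟩
  · refine ⟨?_, exists_compl_subset tree hv⟩
    obtain ⟨u, hu, rfl⟩ := mem_extendDiagram.1 hv
    exact (mem u).1 hu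
  · exact mem_extendDiagram.2 (lift v hv.1 hv.2)

/-- Both parts can be read off from the joined diagram by the side of each vertex, which gives
injectivity. Surjectivity cuts T at the line from either side and uses that every vertex lies on one
of them. -/
theorem bijOn_joinDiagrams (h1 : S.Nonempty) (h2 : Sᶜ.Nonempty) :
    Set.BijOn (joinDiagrams S) {T | IsTreeDiagram T.1 ∧ IsTreeDiagram T.2}
      {T | IsTreeDiagram T ∧ HasLine T S} := by
  have h1' : Sᶜᶜ.Nonempty := by rwa [compl_compl]
  refine ⟨?_, ?_, ?_⟩
  · rintro ⟨T₁, T₂⟩ ⟨hT₁, hT₂⟩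
    refine ⟨isTreeDiagram_join h1 h2 hT₁ hT₂, ?_, ?_⟩
    · obtain ⟨v, hv, h⟩ := compl_mem_extendDiagram hT₂
      rw [compl_compl] at h
      exact ⟨v, Finset.mem_union_right _ hv, h⟩
    · obtain ⟨v, hv, h⟩ := compl_mem_extendDiagram hT₁
      exact ⟨v, Finset.mem_union_left _ hv, h⟩
  · rintro ⟨T₁, T₂⟩ ⟨hT₁, hT₂⟩ ⟨T₁', T₂'⟩ ⟨hT₁', hT₂'⟩ h
    rw [Prod.mk.injEq]
    constructor
    · refine extendDiagram_injective h2 (Finset.ext fun v => ?_)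
      rw [mem_extendDiagram_iff_join h1 hT₁ hT₂, h, ← mem_extendDiagram_iff_join h1 hT₁' hT₂']
    · refine extendDiagram_injective h1' (Finset.ext fun v => ?_)
      rw [mem_extendDiagram_compl_iff_join h2 hT₁ hT₂, h,
        ← mem_extendDiagram_compl_iff_join h2 hT₁' hT₂']
  · rintro T ⟨hT, ⟨v₀, hv₀, hSv₀⟩, w₀, hw₀, hSw₀⟩
    obtain ⟨T₁, hT₁, mem₁⟩ := exists_extendDiagram_eq h2 hT hw₀ hSw₀
    obtain ⟨T₂, hT₂, mem₂⟩ := exists_extendDiagram_eq (S := Sᶜ) h1' hT hv₀ (by rwa [compl_compl])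
    refine ⟨(T₁, T₂), ⟨hT₁, hT₂⟩, Finset.ext fun v => ?_⟩
    rw [mem_joinDiagrams, mem₁, mem₂, compl_compl, ← and_or_left]
    refine ⟨fun h => h.1, fun hv => ⟨hv, ?_⟩⟩
    obtain ⟨A, hA, h | h⟩ := hT.exists_superset hv hw₀ hSw₀
    · exact Or.inl ⟨A, hA, h⟩
    · exact Or.inr ⟨A, hA, by rwa [compl_compl] at h⟩

end Pull

end RxiGauge

end

noncomputable section

namespace RxiGauge

/-! ### Signs -/

/-- The sign `(-1)^F` of a parity. -/
def paritySign (b : Bool) : ℂ := if b then -1 else 1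

theorem paritySign_mul_self (b : Bool) : paritySign b * paritySign b = 1 := by
  cases b <;> simp [paritySign]

theorem exchangeSign_mul_self (a b : Bool) : exchangeSign a b * exchangeSign a b = 1 := by
  cases a <;> cases b <;> simp [exchangeSign]

theorem exchangeSign_comm (a b : Bool) : exchangeSign a b = exchangeSign b a := by
  cases a <;> cases b <;> simp [exchangeSign]

section Signs

variable {E : Type*} [LinearOrder E] (odd : E → Bool)

/-- The sign `(-1)^F` of a set of legs. -/
def legSign (A : Finset E) : ℂ := ∏ e ∈ A, paritySign (odd e)

/-- The sign of the inversion of two legs. -/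
def pairSign (x y : E) : ℂ := if odd x ∧ odd y ∧ y < x then -1 else 1

/-- The sign of the inversions between two blocks of legs. -/
def blockSign (A B : Finset E) : ℂ := ∏ x ∈ A, ∏ y ∈ B, pairSign odd x y

theorem pairSign_mul_self (x y : E) : pairSign odd x y * pairSign odd x y = 1 := by
  unfold pairSign; split_ifs <;> norm_num

theorem blockSign_mul_self (A B : Finset E) : blockSign odd A B * blockSign odd A B = 1 := by
  simp [blockSign, ← Finset.prod_mul_distrib, pairSign_mul_self]

/-- Counting inversions turns into a product of signs over pairs of legs, which can be regrouped
freely. -/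
theorem shuffleSign_cons (A : Finset E) (l : List (Finset E)) :
    shuffleSign odd (A :: l) = (l.map (blockSign odd A)).prod * shuffleSign odd l := by
  have h : ∀ B, (-1 : ℂ) ^ ((A ×ˢ B).filter fun x => odd x.1 ∧ odd x.2 ∧ x.2 < x.1).card =
      blockSign odd A B := by
    intro B
    rw [blockSign, ← Finset.prod_product', ← Finset.prod_const, Finset.prod_filter]
    rfl
  rw [shuffleSign]
  congr 1
  induction l with
  | nil => simp
  | cons B l ih => rw [List.map_cons, List.sum_cons, pow_add, h, ih, List.map_cons, List.prod_cons]

theorem shuffleSign_pair (A B : Finset E) : shuffleSign odd [A, B] = blockSign odd A B := by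
  rw [shuffleSign_cons, shuffleSign_cons]
  simp [shuffleSign]

/-- Every pair of fermionic legs from the two disjoint blocks is inverted in exactly one of the two
orders, so the product is (-1)^(mn) with m, n the numbers of fermions; only their parities matter.
-/
theorem blockSign_mul_swap {A B : Finset E} (hAB : Disjoint A B) {a b : Bool}
    (ha : paritySign a = legSign odd A) (hb : paritySign b = legSign odd B) :
    blockSign odd A B * blockSign odd B A = exchangeSign a b := by
  have h1 : ∀ x ∈ A, ∏ y ∈ B, pairSign odd x y * pairSign odd y x =
      if odd x then paritySign b else 1 := by
    intro x hx
    have h2 : ∀ y ∈ B, pairSign odd x y * pairSign odd y x =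
        if odd x then paritySign (odd y) else 1 := by
      intro y hy
      have hne : x ≠ y := fun h => Finset.disjoint_left.1 hAB hx (h ▸ hy)
      unfold pairSign paritySign
      rcases lt_or_gt_of_ne hne with h | h <;> cases odd x <;> cases odd y <;> simp [h, h.le]
    rw [Finset.prod_congr rfl h2, hb]
    split_ifs <;> simp [legSign]
  have hsplit : blockSign odd B A = ∏ x ∈ A, ∏ y ∈ B, pairSign odd y x := Finset.prod_comm
  rw [hsplit, blockSign, ← Finset.prod_mul_distrib]
  simp_rw [← Finset.prod_mul_distrib]
  rw [Finset.prod_congr rfl h1]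
  cases b
  · simp [paritySign, exchangeSign]
  · have : ∏ x ∈ A, (if odd x then paritySign true else 1) = legSign odd A := by
      simp [legSign, paritySign]
    rw [this, ← ha]
    cases a <;> simp [paritySign, exchangeSign]

theorem blockSign_eq_exchangeSign_mul {A B : Finset E} (hAB : Disjoint A B) {a b : Bool}
    (ha : paritySign a = legSign odd A) (hb : paritySign b = legSign odd B) :
    blockSign odd A B = exchangeSign a b * blockSign odd B A := by
  rw [← blockSign_mul_swap odd hAB ha hb, mul_assoc, blockSign_mul_self, mul_one]

theorem shuffleSign_append_swap (l₀ l : List (Finset E)) {A B : Finset E} (hAB : Disjoint A B)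
    {a b : Bool} (ha : paritySign a = legSign odd A) (hb : paritySign b = legSign odd B) :
    shuffleSign odd (l₀ ++ A :: B :: l) =
      exchangeSign a b * shuffleSign odd (l₀ ++ B :: A :: l) := by
  induction l₀ with
  | nil =>
    simp only [List.nil_append, shuffleSign_cons, List.map_cons, List.prod_cons]
    rw [blockSign_eq_exchangeSign_mul odd hAB ha hb]
    ring
  | cons C l₀ ih =>
    rw [List.cons_append, List.cons_append, shuffleSign_cons, shuffleSign_cons, ih]
    have hp : (l₀ ++ A :: B :: l).Perm (l₀ ++ B :: A :: l) :=
      List.Perm.append_left _ (List.Perm.swap _ _ _)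
    rw [(hp.map (blockSign odd C)).prod_eq]
    ring

theorem legSign_biUnion {v : Finset (Finset E)}
    (hv : ∀ A ∈ v, ∀ B ∈ v, A ≠ B → Disjoint A B) :
    legSign odd (v.biUnion id) = ∏ A ∈ v, legSign odd A := by
  unfold legSign
  rw [Finset.prod_biUnion]
  · rfl
  · exact fun A hA B hB h => hv A hA B hB h

end Signs

/-! ### Diagrams with labels on all sets of legs -/

namespace FeynmanRules

/-! ### Graded symmetry and parity of the propagators -/

section Propagator

variable {G M : Type*} [Fintype M] [DecidableEq M] (Th : FeynmanRules G M)

theorem msq_neg (p : Momentum) : msq (-p) = msq p := by simp [msq]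

theorem metric_comm (μ ν : Fin 4) : metric μ ν = metric ν μ := by
  by_cases h : μ = ν
  · rw [h]
  · simp [metric, h, Ne.symm h]

/-- Between equal parities the exchange sign is the parity sign of one index, and all other entries
vanish. Graded symmetry thus becomes a matrix identity, which can be inverted. -/
theorem kin_eq (p : Momentum) :
    Th.kin p = Matrix.diagonal (fun i => paritySign (Th.odd i)) * (Th.kin (-p)).transpose := by
  ext i j
  rw [Matrix.diagonal_mul, Matrix.transpose_apply, Th.kin_symm p i j]
  by_cases h : Th.odd i = Th.odd j
  · rw [h]
    cases Th.odd j <;> simp [exchangeSign, paritySign]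
  · rw [Th.kin_parity (-p) j i (Ne.symm h)]
    simp

theorem diagonal_inv : (Matrix.diagonal (fun i => paritySign (Th.odd i)) : Matrix M M ℂ)⁻¹ =
    Matrix.diagonal (fun i => paritySign (Th.odd i)) := by
  apply Matrix.inv_eq_right_inv
  rw [Matrix.diagonal_mul_diagonal]
  simp [paritySign_mul_self]

/-- Parity conservation is invariance under conjugation by Λ = (-1)^F, and this passes to the
inverse because Λ⁻¹ = Λ. Invertibility of the kinetic operator is not needed: the product rule for
`⁻¹` holds for all square matrices. -/
theorem kin_inv_parity (p : Momentum) (i j : M) (h : Th.odd i ≠ Th.odd j) :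
    (Th.kin p)⁻¹ i j = 0 := by
  set Λ : Matrix M M ℂ := Matrix.diagonal (fun i => paritySign (Th.odd i)) with hΛ
  have h1 : Λ * Th.kin p * Λ = Th.kin p := by
    ext a b
    rw [hΛ, Matrix.mul_diagonal, Matrix.diagonal_mul]
    by_cases hab : Th.odd a = Th.odd b
    · rw [hab, mul_right_comm, paritySign_mul_self, one_mul]
    · rw [Th.kin_parity p a b hab]; simp
  have h2 : Λ * (Th.kin p)⁻¹ * Λ = (Th.kin p)⁻¹ := by
    conv_rhs => rw [← h1, Matrix.mul_inv_rev, Matrix.mul_inv_rev, hΛ, diagonal_inv, ← hΛ]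
    rw [Matrix.mul_assoc]
  have h3 := congrFun (congrFun h2 i) j
  rw [hΛ, Matrix.mul_diagonal, Matrix.diagonal_mul] at h3
  revert h h3
  cases Th.odd i <;> cases Th.odd j <;> simp [paritySign] <;> intro h3
  · linear_combination (-1 / 2 : ℂ) * h3
  · linear_combination (-1 / 2 : ℂ) * h3

theorem kin_inv_symm (p : Momentum) (i j : M) :
    (Th.kin p)⁻¹ i j = exchangeSign (Th.odd i) (Th.odd j) * (Th.kin (-p))⁻¹ j i := by
  have h1 : (Th.kin p)⁻¹ i j = (Th.kin (-p))⁻¹ j i * paritySign (Th.odd j) := by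
    rw [kin_eq, Matrix.mul_inv_rev, diagonal_inv, Matrix.mul_diagonal,
      ← Matrix.transpose_nonsing_inv, Matrix.transpose_apply]
  by_cases h : Th.odd i = Th.odd j
  · rw [h1, h, mul_comm]
    cases Th.odd j <;> simp [exchangeSign, paritySign]
  · rw [h1, Th.kin_inv_parity _ _ _ (Ne.symm h)]
    simp

theorem propagator_parity (ξ : ℝ) (p : Momentum) (c c' : Th.Comp)
    (h : Th.propagator ξ p c c' ≠ 0) : Th.parity c = Th.parity c' := by
  rcases c with ⟨a, μ⟩ | ⟨a, ha⟩ | i <;> rcases c' with ⟨b, ν⟩ | ⟨b, hb⟩ | j <;>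
    simp only [parity, Component.isOdd] <;> try exact absurd rfl h
  by_contra hne
  exact h (by simp only [propagator, Th.kin_inv_parity p i j hne, mul_zero])

theorem propagator_symm (ξ : ℝ) (p : Momentum) (c c' : Th.Comp) :
    Th.propagator ξ p c c' =
      exchangeSign (Th.parity c) (Th.parity c') * Th.propagator ξ (-p) c' c := by
  rcases c with ⟨a, μ⟩ | ⟨a, ha⟩ | i <;> rcases c' with ⟨b, ν⟩ | ⟨b, hb⟩ | j <;>
    simp only [parity, Component.isOdd, propagator, mul_zero]
  · by_cases h : a = b
    · subst h
      simp [exchangeSign, msq_neg, metric_comm μ ν, mul_comm (p μ)]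
    · simp [h, Ne.symm h]
  · by_cases h : a = b
    · subst h
      simp [exchangeSign, msq_neg]
    · simp [h, Ne.symm h]
  · rw [Th.kin_inv_symm p i j]
    ring

theorem unphysicalPropagator_parity (ξ : ℝ) (p : Momentum) (c c' : Th.Comp)
    (h : Th.unphysicalPropagator ξ p c c' ≠ 0) : Th.parity c = false ∧ Th.parity c' = false := by
  rcases c with ⟨a, μ⟩ | ⟨a, ha⟩ | i <;> rcases c' with ⟨b, ν⟩ | ⟨b, hb⟩ | j <;>
    simp only [parity, Component.isOdd, and_self] <;> exact absurd rfl h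

theorem unphysicalPropagator_symm (ξ : ℝ) (p : Momentum) (c c' : Th.Comp) :
    Th.unphysicalPropagator ξ p c c' = Th.unphysicalPropagator ξ p c' c := by
  rcases c with ⟨a, μ⟩ | ⟨a, ha⟩ | i <;> rcases c' with ⟨b, ν⟩ | ⟨b, hb⟩ | j <;>
    simp only [unphysicalPropagator]
  · by_cases h : a = b
    · subst h
      simp [mul_comm (p μ)]
    · simp [h, Ne.symm h]
  · by_cases h : a = b
    · subst h
      simp
    · simp [h, Ne.symm h]

end Propagator

/-! ### Vertex values and conservation of parity -/

section Values

variable {G M : Type*} (Th : FeynmanRules G M)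
variable {E : Type*} [Fintype E] [LinearOrder E]

/-- The parities of the external legs. -/
abbrev legOdd {Th : FeynmanRules G M} (legs : E → Th.Leg) : E → Bool := fun e => (legs e).odd

/-- The value of a vertex with the half-lines `l` in the given order. -/
def vertexValue (legs : E → Th.Leg) (g : Finset E → Th.Comp) (l : List (Finset E)) : ℂ :=
  shuffleSign (legOdd legs) l * Th.vertex (l.map fun A => (g A, momentum legs A))

/-- The parity of a label is the parity of the legs behind the half-line. -/
def Consistent (legs : E → Th.Leg) (s : Finset (Finset E)) (g : Finset E → Th.Comp) : Prop :=
  ∀ A ∈ s, paritySign (Th.parity (g A)) = legSign (legOdd legs) A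

variable {Th}

/-- The exchange sign of the two labels in the vertex function cancels the exchange sign of the legs
behind the two half-lines, because the parities agree. -/
theorem vertexValue_swap (legs : E → Th.Leg) (g : Finset E → Th.Comp) (l₀ l : List (Finset E))
    {A B : Finset E} (hAB : Disjoint A B)
    (hA : paritySign (Th.parity (g A)) = legSign (legOdd legs) A)
    (hB : paritySign (Th.parity (g B)) = legSign (legOdd legs) B) :
    Th.vertexValue legs g (l₀ ++ A :: B :: l) = Th.vertexValue legs g (l₀ ++ B :: A :: l) := by
  unfold vertexValue
  rw [shuffleSign_append_swap _ l₀ l hAB hA hB]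
  simp only [List.map_append, List.map_cons]
  rw [Th.vertex_swap]
  linear_combination (shuffleSign (legOdd legs) (l₀ ++ B :: A :: l) *
    Th.vertex (List.map (fun A => (g A, momentum legs A)) l₀ ++ (g B, momentum legs B) ::
      (g A, momentum legs A) :: List.map (fun A => (g A, momentum legs A)) l)) *
    exchangeSign_mul_self (Th.parity (g A)) (Th.parity (g B))

/-- The prefix `l₀` makes the induction on permutations work: a common head is moved into it. -/
theorem vertexValue_perm_append (legs : E → Th.Leg) (g : Finset E → Th.Comp)
    {l l' : List (Finset E)} (h : l.Perm l') : ∀ l₀ : List (Finset E),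
    (l₀ ++ l).Pairwise Disjoint →
    (∀ A ∈ l₀ ++ l, paritySign (Th.parity (g A)) = legSign (legOdd legs) A) →
    Th.vertexValue legs g (l₀ ++ l) = Th.vertexValue legs g (l₀ ++ l') := by
  induction h with
  | nil => exact fun _ _ _ => rfl
  | cons A h ih =>
    intro l₀ hd hc
    have := ih (l₀ ++ [A]) (by simpa using hd) (by simpa using hc)
    simpa using this
  | swap A B l =>
    intro l₀ hd hc
    refine vertexValue_swap legs g l₀ l ?_ (hc _ (by simp)) (hc _ (by simp))
    rw [List.pairwise_append] at hd
    exact (List.pairwise_cons.1 hd.2.1).1 A (by simp)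
  | trans h₁ h₂ ih₁ ih₂ =>
    intro l₀ hd hc
    have hp := List.Perm.append_left l₀ h₁
    rw [ih₁ l₀ hd hc]
    exact ih₂ l₀ ((hp.pairwise_iff fun h => h.symm).1 hd)
      fun A hA => hc A (hp.mem_iff.2 hA)

theorem vertexValue_perm (legs : E → Th.Leg) {g : Finset E → Th.Comp} {v : Finset (Finset E)}
    (hv : IsPartition v) (hc : Th.Consistent legs v g) {l l' : List (Finset E)}
    (hl : l.Perm v.toList) (hl' : l'.Perm v.toList) :
    Th.vertexValue legs g l = Th.vertexValue legs g l' := by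
  have hmem : ∀ A ∈ l, A ∈ v := fun A hA => Finset.mem_toList.1 (hl.mem_iff.1 hA)
  have hnd : l.Nodup := hl.nodup_iff.2 v.nodup_toList
  refine vertexValue_perm_append legs g (hl.trans hl'.symm) [] ?_ fun A hA => hc A (hmem A hA)
  exact List.Pairwise.imp_of_mem (fun hA hB h => hv.disjoint (hmem _ hA) (hmem _ hB) h) hnd

theorem prod_paritySign_eq_pow (l : List (Th.Comp × Momentum)) :
    (l.map fun x => paritySign (Th.parity x.1)).prod =
      (-1) ^ l.countP fun x => x.1.isOdd Th.odd := by
  induction l with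
  | nil => simp
  | cons x l ih =>
    rw [List.map_cons, List.prod_cons, ih, List.countP_cons, pow_add, mul_comm]
    congr 1
    show paritySign (x.1.isOdd Th.odd) = _
    cases x.1.isOdd Th.odd <;> simp [paritySign]

theorem prod_paritySign_of_vertexValue_ne_zero (legs : E → Th.Leg) {g : Finset E → Th.Comp}
    {v : Finset (Finset E)} {l : List (Finset E)} (hl : l.Perm v.toList)
    (h : Th.vertexValue legs g l ≠ 0) : ∏ A ∈ v, paritySign (Th.parity (g A)) = 1 := by
  have hv := right_ne_zero_of_mul h
  have he : Even ((l.map fun A => (g A, momentum legs A)).countP fun x => x.1.isOdd Th.odd) := by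
    by_contra hne
    exact hv (Th.vertex_parity _ (Nat.not_even_iff_odd.1 hne))
  have h1 := prod_paritySign_eq_pow (l.map fun A => (g A, momentum legs A))
  rw [he.neg_one_pow, List.map_map] at h1
  rw [← h1, ← Finset.prod_map_toList, ← (hl.map _).prod_eq]
  rfl

/-- The half-lines at `v`, in the order in which `vertexFactor` lists them. -/
theorem vertexFactor_eq (legs : E → Th.Leg) (T : Finset (Finset (Finset E)))
    {v : Finset (Finset E)} (hv : v ∈ T) : ∃ l : List (Finset E), l.Perm v.toList ∧
      ∀ g : Finset E → Th.Comp,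
        Th.vertexFactor legs T (fun h => g h.1) v = Th.vertexValue legs g l := by
  refine ⟨((Finset.univ.filter fun h : HalfLine T => h.1 ∈ v).toList).map fun h => h.1, ?_, ?_⟩
  · refine (List.perm_ext_iff_of_nodup ?_ v.nodup_toList).2 fun A => ?_
    · exact (Finset.nodup_toList _).map Subtype.val_injective
    · simp only [List.mem_map, Finset.mem_toList, Finset.mem_filter, Finset.mem_univ, true_and]
      constructor
      · rintro ⟨h, hh, rfl⟩
        exact hh
      · exact fun hA => ⟨⟨A, Finset.mem_biUnion.2 ⟨v, hv, hA⟩⟩, hA, rfl⟩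
  · intro g
    simp only [vertexFactor, vertexValue, List.map_map]
    rfl

/-- A label whose parity is conserved along the diagram is determined by the legs. -/
theorem consistent_of_conserved (legs : E → Th.Leg) {g : Finset E → Th.Comp}
    {T : Finset (Finset (Finset E))} (hT : IsTreeDiagram T)
    (hvert : ∀ v ∈ T, ∏ A ∈ v, paritySign (Th.parity (g A)) = 1)
    (hline : ∀ A ∈ T.biUnion id, Aᶜ ∈ T.biUnion id → Th.parity (g A) = Th.parity (g Aᶜ))
    (hleg : ∀ e, Th.parity (g {e}) = (legs e).odd) : Th.Consistent legs (T.biUnion id) g := by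
  have key : ∀ n : ℕ, ∀ A ∈ T.biUnion id, A.card ≤ n →
      paritySign (Th.parity (g A)) = legSign (legOdd legs) A := by
    intro n
    induction n with
    | zero =>
      intro A hA hc
      exact absurd (Finset.card_pos.2 (hT.halfLine_nonempty hA)) (by omega)
    | succ n ih =>
      intro A hA hc
      have hpos := Finset.card_pos.2 (hT.halfLine_nonempty hA)
      by_cases h1 : A.card = 1
      · obtain ⟨e, rfl⟩ := Finset.card_eq_one.1 h1
        rw [hleg e]
        simp [legSign]
      · obtain ⟨v, hv, hAv⟩ := Finset.mem_biUnion.1 hA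
        -- At the far end `w` of the line A the remaining blocks partition A and are smaller. Parity
        -- conservation at `w` therefore determines the label of Aᶜ, and the line carries this over
        -- to A.
        obtain ⟨w, hw, hAw⟩ := hT.joined v hv A hAv (by omega)
        have hAw' : Aᶜ ∈ T.biUnion id := Finset.mem_biUnion.2 ⟨w, hw, hAw⟩
        have pw := hT.partition w hw
        have hunion := pw.erase_biUnion hAw
        rw [compl_compl] at hunion
        have hsub : ∀ B ∈ w.erase Aᶜ, B ⊆ A := fun B hB => by
          rw [← hunion]
          exact Finset.subset_biUnion_of_mem id hB
        have hB : ∀ B ∈ w.erase Aᶜ, paritySign (Th.parity (g B)) = legSign (legOdd legs) B := by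
          intro B hB
          have hBw := Finset.mem_of_mem_erase hB
          have hne : B ≠ A := by
            rintro rfl
            exact pw.union_ne_univ (hT.three_le w hw) hBw hAw (by simp)
          have := Finset.card_lt_card ((hsub B hB).ssubset_of_ne hne)
          exact ih B (Finset.mem_biUnion.2 ⟨w, hw, hBw⟩) (by omega)
        have hw1 := hvert w hw
        rw [← Finset.mul_prod_erase w _ hAw, Finset.prod_congr rfl hB,
          ← legSign_biUnion _ fun B hB C hC h => pw.disjoint (Finset.mem_of_mem_erase hB)
            (Finset.mem_of_mem_erase hC) h, hunion] at hw1
        rw [hline A hA hAw']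
        linear_combination legSign (legOdd legs) A *
          paritySign_mul_self (Th.parity (g Aᶜ)) - paritySign (Th.parity (g Aᶜ)) * hw1
  exact fun A hA => key _ A hA le_rfl

theorem legSign_univ_of_consistent (legs : E → Th.Leg) {g : Finset E → Th.Comp}
    {T : Finset (Finset (Finset E))} (hT : IsTreeDiagram T)
    (hvert : ∀ v ∈ T, ∏ A ∈ v, paritySign (Th.parity (g A)) = 1)
    (hc : Th.Consistent legs (T.biUnion id) g) : legSign (legOdd legs) Finset.univ = 1 := by
  obtain ⟨v, hv⟩ := hT.nonempty
  have pv := hT.partition v hv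
  rw [← pv.biUnion_eq_univ, legSign_biUnion _ fun A hA B hB h => pv.disjoint hA hB h,
    ← hvert v hv]
  exact Finset.prod_congr rfl fun A hA => (hc A (Finset.mem_biUnion.2 ⟨v, hv, hA⟩)).symm

theorem momentum_compl {legs : E → Th.Leg} (hmom : ∑ e, (legs e).mom = 0) (A : Finset E) :
    momentum legs Aᶜ = -momentum legs A := by
  have h := Finset.sum_add_sum_compl A fun e => (legs e).mom
  rw [hmom] at h
  exact eq_neg_of_add_eq_zero_right h

theorem Consistent.mono {legs : E → Th.Leg} {g : Finset E → Th.Comp}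
    {T : Finset (Finset (Finset E))} (hc : Th.Consistent legs (T.biUnion id) g)
    {v : Finset (Finset E)} (hv : v ∈ T) : Th.Consistent legs v g :=
  fun A hA => hc A (Finset.mem_biUnion.2 ⟨v, hv, hA⟩)

end Values

/-! ### Internal lines with a chosen orientation -/

section Lines

variable {E : Type*} [Fintype E] [LinearOrder E]

/-- The internal lines of a diagram, represented by the side that contains the first leg. -/
def lines (T : Finset (Finset (Finset E))) : Finset (Finset E) :=
  (T.biUnion id).filter fun A => Aᶜ ∈ T.biUnion id ∧ A.min < Aᶜ.min

theorem mem_lines {T : Finset (Finset (Finset E))} {A : Finset E} :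
    A ∈ lines T ↔ A ∈ T.biUnion id ∧ Aᶜ ∈ T.biUnion id ∧ A.min < Aᶜ.min := Finset.mem_filter

theorem compl_notMem_lines {T : Finset (Finset (Finset E))} {A : Finset E} (h : A ∈ lines T) :
    Aᶜ ∉ lines T := by
  intro h'
  have h1 := (mem_lines.1 h).2.2
  have h2 := (mem_lines.1 h').2.2
  rw [compl_compl] at h2
  exact lt_asymm h1 h2

theorem mem_lines_or {T : Finset (Finset (Finset E))} (hT : IsTreeDiagram T) {A : Finset E}
    (h : A ∈ T.biUnion id) (h' : Aᶜ ∈ T.biUnion id) : A ∈ lines T ∨ Aᶜ ∈ lines T := by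
  rcases lt_trichotomy A.min Aᶜ.min with hlt | heq | hlt
  · exact Or.inl (mem_lines.2 ⟨h, h', hlt⟩)
  · obtain ⟨a, ha⟩ := Finset.min_of_nonempty (hT.halfLine_nonempty h)
    have h1 := Finset.mem_of_min ha
    have h2 := Finset.mem_of_min (heq ▸ ha)
    exact absurd h1 (Finset.mem_compl.1 h2)
  · exact Or.inr (mem_lines.2 ⟨h', by rwa [compl_compl], by rwa [compl_compl]⟩)

theorem two_le_card_of_mem_lines {T : Finset (Finset (Finset E))} (hT : IsTreeDiagram T)
    {A : Finset E} (h : A ∈ lines T) : 2 ≤ A.card ∧ 2 ≤ Aᶜ.card := by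
  have h1 := hT.two_le_card_compl (mem_lines.1 h).1
  have h2 := hT.two_le_card_compl (mem_lines.1 h).2.1
  rw [compl_compl] at h2
  exact ⟨h2, h1⟩

theorem prod_halfLine_pairs (T : Finset (Finset (Finset E))) (F : Finset E → Finset E → ℂ) :
    ∏ x : HalfLine T × HalfLine T with x.2.1 = x.1.1ᶜ ∧ x.1.1.min < x.2.1.min, F x.1.1 x.2.1 =
      ∏ A ∈ lines T, F A Aᶜ := by
  refine Finset.prod_bij (fun x _ => x.1.1) ?_ ?_ ?_ ?_
  · rintro ⟨⟨A, hA⟩, ⟨B, hB⟩⟩ hx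
    obtain ⟨h1, h2⟩ := (Finset.mem_filter.1 hx).2
    dsimp only at h1 h2 ⊢
    subst h1
    exact mem_lines.2 ⟨hA, hB, h2⟩
  · rintro ⟨⟨A, hA⟩, ⟨B, hB⟩⟩ hx ⟨⟨A', hA'⟩, ⟨B', hB'⟩⟩ hx' h
    obtain ⟨h1, -⟩ := (Finset.mem_filter.1 hx).2
    obtain ⟨h1', -⟩ := (Finset.mem_filter.1 hx').2
    dsimp only at h h1 h1'
    subst h h1 h1'
    rfl
  · intro A hA
    obtain ⟨h1, h2, h3⟩ := mem_lines.1 hA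
    exact ⟨(⟨A, h1⟩, ⟨Aᶜ, h2⟩), Finset.mem_filter.2 ⟨Finset.mem_univ _, rfl, h3⟩, rfl⟩
  · rintro x hx
    rw [(Finset.mem_filter.1 hx).2.1]

theorem prod_external (T : Finset (Finset (Finset E))) (hT : IsTreeDiagram T)
    (F : E → Finset E → ℂ) :
    ∏ x : E × HalfLine T with x.2.1 = {x.1}, F x.1 x.2.1 = ∏ e, F e {e} := by
  refine Finset.prod_bij (fun x _ => x.1) (fun _ _ => Finset.mem_univ _) ?_ ?_ ?_
  · rintro ⟨e, ⟨A, hA⟩⟩ hx ⟨e', ⟨A', hA'⟩⟩ hx' h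
    have h1 := (Finset.mem_filter.1 hx).2
    have h1' := (Finset.mem_filter.1 hx').2
    dsimp only at h h1 h1'
    subst h h1 h1'
    rfl
  · intro e _
    exact ⟨(e, ⟨{e}, hT.singleton_mem e⟩), Finset.mem_filter.2 ⟨Finset.mem_univ _, rfl⟩, rfl⟩
  · rintro x hx
    rw [(Finset.mem_filter.1 hx).2]

end Lines

/-! ### Diagram values with labels on all sets of legs -/

section Term

variable {G M : Type*} [Fintype M] [DecidableEq M] {Th : FeynmanRules G M}
variable {E : Type*} [Fintype E] [LinearOrder E]

/-- The value of the internal line `A`. -/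
def lineValue (ξ : ℝ) (legs : E → Th.Leg) (g : Finset E → Th.Comp) (A : Finset E) : ℂ :=
  blockSign (legOdd legs) Aᶜ A * Th.propagator ξ (momentum legs A) (g A) (g Aᶜ)

/-- The product of the vertices of a diagram. -/
def vertexProd (legs : E → Th.Leg) (T : Finset (Finset (Finset E))) (g : Finset E → Th.Comp) :
    ℂ := ∏ v ∈ T, Th.vertexValue legs g v.toList

/-- The product of the wave functions. -/
def waveProd (legs : E → Th.Leg) (g : Finset E → Th.Comp) : ℂ := ∏ e, (legs e).wave (g {e})

/-- `diagramTerm` for labels that are given on all sets of legs. -/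
def treeTerm (ξ : ℝ) (legs : E → Th.Leg) (T : Finset (Finset (Finset E)))
    (g : Finset E → Th.Comp) : ℂ :=
  vertexProd legs T g * (∏ A ∈ lines T, lineValue ξ legs g A) * waveProd legs g

theorem parity_of_waveProd_ne_zero {legs : E → Th.Leg} {g : Finset E → Th.Comp}
    (h : waveProd legs g ≠ 0) (e : E) : Th.parity (g {e}) = (legs e).odd := by
  by_contra hne
  exact Finset.prod_ne_zero_iff.1 h e (Finset.mem_univ e) ((legs e).wave_parity _ hne)

theorem parity_of_lines {T : Finset (Finset (Finset E))} (hT : IsTreeDiagram T)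
    {g : Finset E → Th.Comp}
    (h : ∀ A ∈ lines T, Th.parity (g A) = Th.parity (g Aᶜ)) {A : Finset E}
    (hA : A ∈ T.biUnion id) (hA' : Aᶜ ∈ T.biUnion id) : Th.parity (g A) = Th.parity (g Aᶜ) := by
  rcases mem_lines_or hT hA hA' with hl | hl
  · exact h A hl
  · simpa using (h _ hl).symm

theorem consistent_of_ne_zero {ξ : ℝ} {legs : E → Th.Leg} {T : Finset (Finset (Finset E))}
    (hT : IsTreeDiagram T) {g : Finset E → Th.Comp}
    (hvert : ∀ v ∈ T, ∏ A ∈ v, paritySign (Th.parity (g A)) = 1)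
    (hline : ∏ A ∈ lines T, lineValue ξ legs g A ≠ 0) (hwave : waveProd legs g ≠ 0) :
    Th.Consistent legs (T.biUnion id) g := by
  refine consistent_of_conserved legs hT hvert (fun A hA hA' => parity_of_lines hT ?_ hA hA')
    (parity_of_waveProd_ne_zero hwave)
  exact fun A hA => Th.propagator_parity ξ _ _ _
    (right_ne_zero_of_mul (Finset.prod_ne_zero_iff.1 hline A hA))

theorem prod_paritySign_of_vertexProd_ne_zero {legs : E → Th.Leg}
    {T : Finset (Finset (Finset E))} {g : Finset E → Th.Comp} (h : vertexProd legs T g ≠ 0) :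
    ∀ v ∈ T, ∏ A ∈ v, paritySign (Th.parity (g A)) = 1 := fun v hv =>
  prod_paritySign_of_vertexValue_ne_zero legs (List.Perm.refl _)
    (Finset.prod_ne_zero_iff.1 h v hv)

theorem treeTerm_ne_zero {ξ : ℝ} {legs : E → Th.Leg} {T : Finset (Finset (Finset E))}
    (hT : IsTreeDiagram T) {g : Finset E → Th.Comp} (h : treeTerm ξ legs T g ≠ 0) :
    Th.Consistent legs (T.biUnion id) g ∧ legSign (legOdd legs) Finset.univ = 1 := by
  have hv := prod_paritySign_of_vertexProd_ne_zero
    (left_ne_zero_of_mul (left_ne_zero_of_mul h))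
  have hc := consistent_of_ne_zero hT hv (right_ne_zero_of_mul (left_ne_zero_of_mul h))
    (right_ne_zero_of_mul h)
  exact ⟨hc, legSign_univ_of_consistent legs hT hv hc⟩

/-- The two sides list the half-lines at a vertex in unrelated orders, which is harmless only for
consistent labels. If either product of vertices is nonzero, together with the lines and wave
functions, the labels are consistent; otherwise both sides vanish. -/
theorem diagramTerm_eq_treeTerm (ξ : ℝ) (legs : E → Th.Leg) {T : Finset (Finset (Finset E))}
    (hT : IsTreeDiagram T) (g : Finset E → Th.Comp) :
    Th.diagramTerm ξ legs T (fun h => g h.1) = treeTerm ξ legs T g := by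
  have h1 : Th.diagramTerm ξ legs T (fun h => g h.1) =
      (∏ v ∈ T, Th.vertexFactor legs T (fun h => g h.1) v) *
        (∏ A ∈ lines T, lineValue ξ legs g A) * waveProd legs g := by
    unfold diagramTerm
    congr 1
    · congr 1
      refine Eq.trans ?_ (prod_halfLine_pairs T fun A B => blockSign (legOdd legs) B A *
        Th.propagator ξ (momentum legs A) (g A) (g B))
      exact Finset.prod_congr rfl fun x _ => by rw [shuffleSign_pair]
    · exact prod_external T hT fun e A => (legs e).wave (g A)
  rw [h1, treeTerm]
  by_cases hz : (∏ A ∈ lines T, lineValue ξ legs g A) = 0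
  · simp [hz]
  by_cases hz' : waveProd legs g = 0
  · simp [hz']
  congr 2
  have key : ∀ hc : Th.Consistent legs (T.biUnion id) g,
      ∏ v ∈ T, Th.vertexFactor legs T (fun h => g h.1) v = vertexProd legs T g := by
    intro hc
    refine Finset.prod_congr rfl fun v hv => ?_
    obtain ⟨l, hl, h⟩ := vertexFactor_eq legs T hv
    rw [h g]
    exact vertexValue_perm legs (hT.partition v hv) (hc.mono hv) hl (List.Perm.refl _)
  by_cases hv : ∏ v ∈ T, Th.vertexFactor legs T (fun h => g h.1) v = 0
  · by_cases hv' : vertexProd legs T g = 0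
    · rw [hv, hv']
    · exact key (consistent_of_ne_zero hT (prod_paritySign_of_vertexProd_ne_zero hv') hz hz')
  · refine key (consistent_of_ne_zero hT (fun v hvT => ?_) hz hz')
    obtain ⟨l, hl, h⟩ := vertexFactor_eq legs T hvT
    have hne := Finset.prod_ne_zero_iff.1 hv v hvT
    rw [h g] at hne
    exact prod_paritySign_of_vertexValue_ne_zero legs hl hne

/-- Reversing the line flips the momentum and exchanges the components; the resulting exchange sign
is the one for interchanging the legs A and Aᶜ. -/
theorem lineValue_compl {ξ : ℝ} {legs : E → Th.Leg} (hmom : ∑ e, (legs e).mom = 0)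
    {g : Finset E → Th.Comp} {A : Finset E}
    (hA : paritySign (Th.parity (g A)) = legSign (legOdd legs) A)
    (hA' : paritySign (Th.parity (g Aᶜ)) = legSign (legOdd legs) Aᶜ) :
    lineValue ξ legs g Aᶜ = lineValue ξ legs g A := by
  unfold lineValue
  rw [compl_compl, momentum_compl hmom,
    blockSign_eq_exchangeSign_mul _ disjoint_compl_right hA hA',
    Th.propagator_symm ξ (-momentum legs A), neg_neg,
    exchangeSign_comm (Th.parity (g Aᶜ))]
  linear_combination (blockSign (legOdd legs) Aᶜ A *
    Th.propagator ξ (momentum legs A) (g A) (g Aᶜ)) *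
    exchangeSign_mul_self (Th.parity (g A)) (Th.parity (g Aᶜ))

end Term

end FeynmanRules

end RxiGauge

end

noncomputable section

namespace RxiGauge

/-! ### Joining two diagrams at a line -/

section Products

variable {E : Type*} [Fintype E] [LinearOrder E] {S : Finset E}

theorem pull_eq_biUnion (A : Finset (WithBot {e // e ∈ S})) :
    pull S A = A.biUnion fun z => pull S {z} := by
  ext e; simp [mem_pull]

theorem prod_pull (A : Finset (WithBot {e // e ∈ S})) (φ : E → ℂ) :
    ∏ e ∈ pull S A, φ e = ∏ z ∈ A, ∏ e ∈ pull S {z}, φ e := by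
  rw [pull_eq_biUnion, Finset.prod_biUnion]
  intro z _ w _ hzw
  refine Finset.disjoint_left.2 fun e he he' => hzw ?_
  rw [mem_pull, Finset.mem_singleton] at he he'
  rw [← he, he']

theorem sum_pull {N : Type*} [AddCommMonoid N] (A : Finset (WithBot {e // e ∈ S})) (φ : E → N) :
    ∑ e ∈ pull S A, φ e = ∑ z ∈ A, ∑ e ∈ pull S {z}, φ e := by
  rw [pull_eq_biUnion, Finset.sum_biUnion]
  intro z _ w _ hzw
  refine Finset.disjoint_left.2 fun e he he' => hzw ?_
  rw [mem_pull, Finset.mem_singleton] at he he'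
  rw [← he, he']

theorem prod_withBot (φ : WithBot {e // e ∈ S} → ℂ) :
    ∏ z, φ z = φ ⊥ * ∏ s : {e // e ∈ S}, φ s :=
  Fintype.prod_option φ

/-- X and Y are two choices of one member from each pair {A, Aᶜ} of the same family, and F does not
see the choice. -/
theorem prod_eq_prod_of_compl {X Y : Finset (Finset E)} {F : Finset E → ℂ}
    (h1 : ∀ A ∈ X, A ∈ Y ∨ Aᶜ ∈ Y) (h2 : ∀ A ∈ Y, A ∈ X ∨ Aᶜ ∈ X)
    (h3 : ∀ A ∈ X, Aᶜ ∉ X) (h4 : ∀ A ∈ Y, Aᶜ ∉ Y) (hF : ∀ A ∈ X, F Aᶜ = F A) :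
    ∏ A ∈ X, F A = ∏ A ∈ Y, F A := by
  refine Finset.prod_bij' (fun A _ => if A ∈ Y then A else Aᶜ)
    (fun A _ => if A ∈ X then A else Aᶜ) ?_ ?_ ?_ ?_ ?_
  · intro A hA
    split_ifs with h
    · exact h
    · exact (h1 A hA).resolve_left h
  · intro A hA
    split_ifs with h
    · exact h
    · exact (h2 A hA).resolve_left h
  · intro A hA
    by_cases h : A ∈ Y <;> simp [h, hA, h3 A hA]
  · intro A hA
    by_cases h : A ∈ X <;> simp [h, hA, h4 A hA]
  · intro A hA
    split_ifs
    · rfl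
    · exact (hF A hA).symm

theorem mem_biUnion_join {T₁ : Finset (Finset (Finset (WithBot {e // e ∈ S})))}
    {T₂ : Finset (Finset (Finset (WithBot {e // e ∈ Sᶜ})))} {A : Finset E} :
    A ∈ (joinDiagrams S (T₁, T₂)).biUnion id ↔
      (∃ B ∈ T₁.biUnion id, pull S B = A) ∨ ∃ B ∈ T₂.biUnion id, pull Sᶜ B = A := by
  simp only [Finset.mem_biUnion, mem_joinDiagrams, id, mem_extendDiagram]
  constructor
  · rintro ⟨v, ⟨w, hw, rfl⟩ | ⟨w, hw, rfl⟩, hA⟩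
    · obtain ⟨B, hB, rfl⟩ := Finset.mem_image.1 hA
      exact Or.inl ⟨B, ⟨w, hw, hB⟩, rfl⟩
    · obtain ⟨B, hB, rfl⟩ := Finset.mem_image.1 hA
      exact Or.inr ⟨B, ⟨w, hw, hB⟩, rfl⟩
  · rintro (⟨B, ⟨w, hw, hB⟩, rfl⟩ | ⟨B, ⟨w, hw, hB⟩, rfl⟩)
    · exact ⟨_, Or.inl ⟨w, hw, rfl⟩, Finset.mem_image_of_mem _ hB⟩
    · exact ⟨_, Or.inr ⟨w, hw, rfl⟩, Finset.mem_image_of_mem _ hB⟩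

end Products

namespace FeynmanRules

/-! ### Cancellation of signs along a tree -/

section LineSets

variable {F : Type*} [Fintype F] [LinearOrder F]

/-- Used with the leg ⊥ of a subamplitude, which is the least one: there all chosen half-lines point
towards ⊥. -/
theorem mem_lines_iff_of_le {b : F} (hb : ∀ e, b ≤ e) {T : Finset (Finset (Finset F))}
    {A : Finset F} : A ∈ lines T ↔ A ∈ T.biUnion id ∧ Aᶜ ∈ T.biUnion id ∧ b ∈ A := by
  have key : ∀ B : Finset F, b ∈ B → B.min < Bᶜ.min := by
    intro B hB
    have h1 : B.min = b := le_antisymm (Finset.min_le hB) (Finset.le_min fun x _ => by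
      exact_mod_cast hb x)
    rw [h1]
    rcases Finset.eq_empty_or_nonempty Bᶜ with h | h
    · rw [h]; simp
    · obtain ⟨x, hx⟩ := Finset.min_of_nonempty h
      rw [hx, WithTop.coe_lt_coe]
      refine lt_of_le_of_ne (hb x) ?_
      rintro rfl
      exact Finset.mem_compl.1 (Finset.mem_of_min hx) hB
  rw [mem_lines]
  refine and_congr_right fun _ => and_congr_right fun _ => ⟨fun h => ?_, key A⟩
  by_contra hA
  have := key Aᶜ (Finset.mem_compl.2 hA)
  rw [compl_compl] at this
  exact lt_asymm h this

/-- In the product of a multiplicative sign over all half-lines that point away from a leg `b`,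
internal lines cancel. -/
theorem prod_halfLines_mul_prod_lines {b : F} (hb : ∀ e, b ≤ e) {T : Finset (Finset (Finset F))}
    (hT : IsTreeDiagram T) {η : F → ℂ} (hη : ∀ e, η e * η e = 1) (hηb : η b = 1) :
    (∏ v ∈ T, ∏ A ∈ v, if b ∈ A then 1 else ∏ e ∈ A, η e) *
      ∏ A ∈ lines T, ∏ e ∈ Aᶜ, η e = ∏ e, η e := by
  have hsq : (∏ A ∈ lines T, ∏ e ∈ Aᶜ, η e) * ∏ A ∈ lines T, ∏ e ∈ Aᶜ, η e = 1 := by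
    simp [← Finset.prod_mul_distrib, hη]
  have h1 : (∏ v ∈ T, ∏ A ∈ v, if b ∈ A then (1 : ℂ) else ∏ e ∈ A, η e) =
      ∏ A ∈ T.biUnion id, if b ∈ A then 1 else ∏ e ∈ A, η e := by
    rw [Finset.prod_biUnion]
    · rfl
    · intro v hv w hw hvw
      exact Finset.disjoint_left.2 fun A hA hA' => hvw (hT.vertex_unique hv hw hA hA')
  -- The half-lines of internal lines that point away from `b` are the complements of the chosen
  -- ones.
  have h2 : (∏ A ∈ T.biUnion id with Aᶜ ∈ T.biUnion id,
      if b ∈ A then (1 : ℂ) else ∏ e ∈ A, η e) = ∏ A ∈ lines T, ∏ e ∈ Aᶜ, η e := by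
    simp_rw [← ite_not (b ∈ _)]
    rw [← Finset.prod_filter]
    refine Finset.prod_bij' (fun A _ => Aᶜ) (fun A _ => Aᶜ) ?_ ?_ ?_ ?_ ?_
    · intro A hA
      simp only [Finset.mem_filter] at hA
      exact (mem_lines_iff_of_le hb).2 ⟨hA.1.2, by simpa using hA.1.1, by simpa using hA.2⟩
    · intro A hA
      rw [mem_lines_iff_of_le hb] at hA
      simp only [Finset.mem_filter]
      exact ⟨⟨hA.2.1, by simpa using hA.1⟩, by simpa using hA.2.2⟩
    · simp
    · simp
    · simp
  -- Half-lines without an opposite one are the single external legs; for `b` itself the factor 1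
  -- agrees with `hηb`.
  have h3 : (∏ A ∈ T.biUnion id with Aᶜ ∉ T.biUnion id,
      if b ∈ A then (1 : ℂ) else ∏ e ∈ A, η e) = ∏ e, η e := by
    symm
    refine Finset.prod_bij (fun e _ => {e}) ?_ ?_ ?_ ?_
    · intro e _
      refine Finset.mem_filter.2 ⟨hT.singleton_mem e, fun h => ?_⟩
      have := hT.two_le_card_compl h
      simp at this
    · exact fun e _ e' _ h => Finset.singleton_injective h
    · intro A hA
      obtain ⟨hA, hA'⟩ := Finset.mem_filter.1 hA
      have hpos := Finset.card_pos.2 (hT.halfLine_nonempty hA)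
      have : ¬ 2 ≤ A.card := fun h => hA' (hT.compl_mem hA h)
      obtain ⟨e, rfl⟩ := Finset.card_eq_one.1 (by omega : A.card = 1)
      exact ⟨e, Finset.mem_univ _, rfl⟩
    · intro e _
      by_cases h : b = e
      · subst h; simp [hηb]
      · simp [h]
  rw [h1, ← Finset.prod_filter_mul_prod_filter_not _ fun A => Aᶜ ∈ T.biUnion id, h2, h3]
  linear_combination (∏ e, η e) * hsq

end LineSets

/-! ### Internal lines of a joined diagram -/

section JoinLines

variable {E : Type*} [Fintype E] [LinearOrder E] {S : Finset E}

theorem bot_le_withBot (e : WithBot {e // e ∈ S}) : ⊥ ≤ e := bot_le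

theorem pull_of_mem_lines (hS : Sᶜ.Nonempty)
    {T : Finset (Finset (Finset (WithBot {e // e ∈ S})))}
    (hT : IsTreeDiagram T) {B : Finset (WithBot {e // e ∈ S})} (hB : B ∈ lines T) :
    Sᶜ ⊆ pull S B ∧ pull S B ≠ Sᶜ ∧ pull S B ≠ Finset.univ := by
  have h2 := two_le_card_of_mem_lines hT hB
  refine ⟨compl_subset_pull ((mem_lines_iff_of_le bot_le_withBot).1 hB).2.2, ?_, ?_⟩
  · rw [← pull_bot]
    intro h
    rw [pull_injective hS h, Finset.card_singleton] at h2
    omega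
  · rw [← pull_univ (S := S)]
    intro h
    rw [pull_injective hS h, Finset.compl_univ, Finset.card_empty] at h2
    omega

theorem mem_or_of_pull {T : Finset (Finset (Finset (WithBot {e // e ∈ S})))}
    (hT : IsTreeDiagram T) {B : Finset (WithBot {e // e ∈ S})} (hB : B ∈ T.biUnion id)
    (h2 : 2 ≤ (pull S B).card) (hne : pull S B ≠ Sᶜ) :
    pull S B ∈ (lines T).image (pull S) ∨ (pull S B)ᶜ ∈ (lines T).image (pull S) := by
  have hB2 : 2 ≤ B.card := by
    by_contra hlt
    have h0 := Finset.card_pos.2 (hT.halfLine_nonempty hB)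
    obtain ⟨x, rfl⟩ := Finset.card_eq_one.1 (by omega : B.card = 1)
    induction x with
    | bot => exact hne pull_bot
    | coe s => rw [pull_coe, Finset.card_singleton] at h2; omega
  rcases mem_lines_or hT hB (hT.compl_mem hB hB2) with h | h
  · exact Or.inl (Finset.mem_image_of_mem _ h)
  · right
    rw [← pull_compl]
    exact Finset.mem_image_of_mem _ h

/-- Lines of the two parts are oriented towards their legs ⊥, those of the joined diagram towards
its first leg. They correspond only up to complement, which is why F must not depend on the
orientation. -/
theorem prod_lines_join (h1 : S.Nonempty) (h2 : Sᶜ.Nonempty)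
    {T₁ : Finset (Finset (Finset (WithBot {e // e ∈ S})))}
    {T₂ : Finset (Finset (Finset (WithBot {e // e ∈ Sᶜ})))}
    (hT₁ : IsTreeDiagram T₁) (hT₂ : IsTreeDiagram T₂)
    (hS : S ∈ lines (joinDiagrams S (T₁, T₂))) {F : Finset E → ℂ}
    (hF : ∀ A ∈ lines (joinDiagrams S (T₁, T₂)), F Aᶜ = F A) :
    ∏ A ∈ (lines (joinDiagrams S (T₁, T₂))).erase S, F A =
      (∏ A ∈ lines T₁, F (pull S A)) * ∏ A ∈ lines T₂, F (pull Sᶜ A) := by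
  have h1' : Sᶜᶜ.Nonempty := by rwa [compl_compl]
  have hT := isTreeDiagram_join h1 h2 hT₁ hT₂
  set T := joinDiagrams S (T₁, T₂) with hTdef
  have f₁ : ∀ A ∈ (lines T₁).image (pull S), Sᶜ ⊆ A ∧ A ≠ Sᶜ ∧ A ≠ Finset.univ := by
    intro A hA
    obtain ⟨B, hB, rfl⟩ := Finset.mem_image.1 hA
    exact pull_of_mem_lines h2 hT₁ hB
  have f₂ : ∀ A ∈ (lines T₂).image (pull Sᶜ), S ⊆ A ∧ A ≠ S ∧ A ≠ Finset.univ := by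
    intro A hA
    obtain ⟨B, hB, rfl⟩ := Finset.mem_image.1 hA
    simpa using pull_of_mem_lines h1' hT₂ hB
  have m₁ : ∀ A ∈ (lines T₁).image (pull S), A ∈ T.biUnion id ∧ Aᶜ ∈ T.biUnion id := by
    intro A hA
    obtain ⟨B, hB, rfl⟩ := Finset.mem_image.1 hA
    rw [← pull_compl]
    exact ⟨mem_biUnion_join.2 (Or.inl ⟨B, (mem_lines.1 hB).1, rfl⟩),
      mem_biUnion_join.2 (Or.inl ⟨_, (mem_lines.1 hB).2.1, rfl⟩)⟩
  have m₂ : ∀ A ∈ (lines T₂).image (pull Sᶜ), A ∈ T.biUnion id ∧ Aᶜ ∈ T.biUnion id := by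
    intro A hA
    obtain ⟨B, hB, rfl⟩ := Finset.mem_image.1 hA
    rw [← pull_compl]
    exact ⟨mem_biUnion_join.2 (Or.inr ⟨B, (mem_lines.1 hB).1, rfl⟩),
      mem_biUnion_join.2 (Or.inr ⟨_, (mem_lines.1 hB).2.1, rfl⟩)⟩
  have hdisj : Disjoint ((lines T₁).image (pull S)) ((lines T₂).image (pull Sᶜ)) :=
    Finset.disjoint_left.2 fun A hA hA' => (f₁ A hA).2.2 <| by
      have := union_eq_univ_of_subset (f₁ A hA).1 (f₂ A hA').1
      rwa [Finset.union_self] at this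
  rw [← Finset.prod_image (f := F) fun A _ B _ h => pull_injective h2 h,
    ← Finset.prod_image (f := F) fun A _ B _ h => pull_injective h1' h,
    ← Finset.prod_union hdisj]
  refine prod_eq_prod_of_compl ?_ ?_ ?_ ?_ fun A hA => hF A (Finset.mem_of_mem_erase hA)
  · intro A hA
    obtain ⟨hne, hA⟩ := Finset.mem_erase.1 hA
    have hc := two_le_card_of_mem_lines hT hA
    have hne' : A ≠ Sᶜ := fun h => compl_notMem_lines hS (h ▸ hA)
    rcases mem_biUnion_join.1 (mem_lines.1 hA).1 with ⟨B, hB, rfl⟩ | ⟨B, hB, rfl⟩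
    · exact (mem_or_of_pull hT₁ hB hc.1 hne').imp (Finset.mem_union_left _)
        (Finset.mem_union_left _)
    · exact (mem_or_of_pull hT₂ hB hc.1 (by rwa [compl_compl])).imp
        (Finset.mem_union_right _) (Finset.mem_union_right _)
  · intro A hA
    have hm : A ∈ T.biUnion id ∧ Aᶜ ∈ T.biUnion id :=
      (Finset.mem_union.1 hA).elim (m₁ A) (m₂ A)
    have hne : A ≠ S ∧ Aᶜ ≠ S := by
      rcases Finset.mem_union.1 hA with h | h
      · obtain ⟨hsub, hne, -⟩ := f₁ A h
        refine ⟨?_, fun h => hne (by rw [← h, compl_compl])⟩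
        rintro rfl
        obtain ⟨e, he⟩ := h2
        exact Finset.mem_compl.1 he (hsub he)
      · obtain ⟨hsub, hne, -⟩ := f₂ A h
        refine ⟨hne, ?_⟩
        rintro rfl
        obtain ⟨e, he⟩ := h1
        exact Finset.mem_compl.1 he (hsub he)
    exact (mem_lines_or hT hm.1 hm.2).imp (fun h => Finset.mem_erase.2 ⟨hne.1, h⟩)
      fun h => Finset.mem_erase.2 ⟨hne.2, h⟩
  · intro A hA hA'
    exact compl_notMem_lines (Finset.mem_of_mem_erase hA) (Finset.mem_of_mem_erase hA')
  · intro A hA hA'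
    rcases Finset.mem_union.1 hA with h | h <;> rcases Finset.mem_union.1 hA' with h' | h'
    · obtain ⟨B, hB, rfl⟩ := Finset.mem_image.1 h
      rw [← pull_compl] at h'
      obtain ⟨C, hC, hCB⟩ := Finset.mem_image.1 h'
      exact compl_notMem_lines hB (pull_injective h2 hCB ▸ hC)
    · refine (f₁ A h).2.1 (subset_antisymm ?_ (f₁ A h).1)
      exact fun x hx => Finset.mem_compl.2 fun hxS =>
        Finset.mem_compl.1 ((f₂ _ h').1 hxS) hx
    · refine (f₂ A h).2.1 (subset_antisymm ?_ (f₂ A h).1)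
      intro x hx
      by_contra hxS
      exact Finset.mem_compl.1 ((f₁ _ h').1 (Finset.mem_compl.2 hxS)) hx
    · obtain ⟨B, hB, rfl⟩ := Finset.mem_image.1 h
      rw [← pull_compl] at h'
      obtain ⟨C, hC, hCB⟩ := Finset.mem_image.1 h'
      exact compl_notMem_lines hB (pull_injective h1' hCB ▸ hC)

end JoinLines

/-! ### Momenta and signs of a subamplitude -/

section SubLegs

variable {G M : Type*} {Th : FeynmanRules G M}
variable {E : Type*} [Fintype E] [LinearOrder E] {S : Finset E}

theorem subLegs_bot (legs : E → Th.Leg) (x : Th.Leg) : subLegs legs S x ⊥ = x := rfl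

theorem subLegs_coe (legs : E → Th.Leg) (x : Th.Leg) (s : {e // e ∈ S}) :
    subLegs legs S x s = legs s.1 := rfl

variable {legs : E → Th.Leg} {x : Th.Leg}

theorem momentum_subLegs (hmom : ∑ e, (legs e).mom = 0) (hx : x.mom = -momentum legs S)
    (A : Finset (WithBot {e // e ∈ S})) :
    momentum (subLegs legs S x) A = momentum legs (pull S A) := by
  unfold momentum
  rw [sum_pull]
  refine Finset.sum_congr rfl fun z _ => ?_
  induction z with
  | bot => rw [subLegs_bot, hx, pull_bot, ← momentum_compl hmom]; rfl
  | coe s => rw [subLegs_coe, pull_coe, Finset.sum_singleton]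

theorem legSign_subLegs (hx : paritySign x.odd = legSign (legOdd legs) Sᶜ)
    (A : Finset (WithBot {e // e ∈ S})) :
    legSign (legOdd (subLegs legs S x)) A = legSign (legOdd legs) (pull S A) := by
  unfold legSign
  rw [prod_pull]
  refine Finset.prod_congr rfl fun z _ => ?_
  induction z with
  | bot => rw [pull_bot]; exact hx
  | coe s => rw [pull_coe, Finset.prod_singleton]; rfl

theorem legSign_subLegs_univ :
    legSign (legOdd (subLegs legs S x)) Finset.univ =
      paritySign x.odd * legSign (legOdd legs) S := by
  unfold legSign
  rw [prod_withBot]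
  congr 1
  exact Finset.prod_coe_sort S fun e => paritySign (legs e).odd

/-- The sign of moving the legs outside of `S` past a leg of the subamplitude. -/
def crossSign (legs : E → Th.Leg) (S : Finset E) (z : WithBot {e // e ∈ S}) : ℂ :=
  WithBot.recBotCoe 1 (fun s => blockSign (legOdd legs) {s.1} Sᶜ) z

theorem crossSign_bot : crossSign legs S ⊥ = 1 := rfl

theorem crossSign_coe (s : {e // e ∈ S}) :
    crossSign legs S s = blockSign (legOdd legs) {s.1} Sᶜ := rfl

theorem crossSign_mul_self (z : WithBot {e // e ∈ S}) :
    crossSign legs S z * crossSign legs S z = 1 := by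
  induction z with
  | bot => simp [crossSign_bot]
  | coe s => rw [crossSign_coe, blockSign_mul_self]

theorem prod_crossSign : ∏ z, crossSign legs S z = blockSign (legOdd legs) S Sᶜ := by
  rw [prod_withBot, crossSign_bot, one_mul]
  simp only [crossSign_coe]
  rw [Finset.prod_coe_sort S fun e => blockSign (legOdd legs) {e} Sᶜ]
  simp [blockSign]

theorem blockSign_pull (A B : Finset (WithBot {e // e ∈ S})) :
    blockSign (legOdd legs) (pull S A) (pull S B) =
      ∏ z ∈ A, ∏ w ∈ B, blockSign (legOdd legs) (pull S {z}) (pull S {w}) := by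
  unfold blockSign
  rw [prod_pull]
  refine Finset.prod_congr rfl fun z _ => ?_
  simp_rw [prod_pull B]
  exact Finset.prod_comm

theorem blockSign_pull_coe_coe (s t : {e // e ∈ S}) :
    blockSign (legOdd legs) (pull S {(s : WithBot {e // e ∈ S})})
      (pull S {(t : WithBot {e // e ∈ S})}) = pairSign (legOdd (subLegs legs S x)) s t := by
  rw [pull_coe, pull_coe, blockSign, Finset.prod_singleton, Finset.prod_singleton]
  simp [pairSign, legOdd, subLegs_coe]

theorem blockSign_pull_coe_bot (hx : x.odd = false) (s : {e // e ∈ S}) :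
    blockSign (legOdd legs) (pull S {(s : WithBot {e // e ∈ S})}) (pull S {⊥}) =
      pairSign (legOdd (subLegs legs S x)) s ⊥ * crossSign legs S s := by
  have : pairSign (legOdd (subLegs legs S x)) s ⊥ = 1 := by
    simp [pairSign, legOdd, subLegs_bot, hx]
  rw [pull_coe, pull_bot, this, one_mul, crossSign_coe]

/-- As Sᶜ is even, it crosses the leg `s` with the same sign from either side; ⊥ itself is least, so
to the left of `s` it is never inverted. -/
theorem blockSign_pull_bot_coe (hS : legSign (legOdd legs) Sᶜ = 1)
    (s : {e // e ∈ S}) :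
    blockSign (legOdd legs) (pull S {⊥}) (pull S {(s : WithBot {e // e ∈ S})}) =
      pairSign (legOdd (subLegs legs S x)) ⊥ s * crossSign legs S s := by
  have : pairSign (legOdd (subLegs legs S x)) ⊥ s = 1 := by
    simp [pairSign]
  rw [pull_coe, pull_bot, this, one_mul, crossSign_coe,
    blockSign_eq_exchangeSign_mul (legOdd legs) (a := false) (b := (legs s.1).odd)]
  · simp [exchangeSign]
  · exact Finset.disjoint_singleton_right.2 fun h => Finset.mem_compl.1 h s.2
  · rw [hS]; simp [paritySign]
  · simp [legSign]

theorem blockSign_pull_of_notMem {A B : Finset (WithBot {e // e ∈ S})} (hA : ⊥ ∉ A)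
    (hB : ⊥ ∉ B) : blockSign (legOdd legs) (pull S A) (pull S B) =
      blockSign (legOdd (subLegs legs S x)) A B := by
  rw [blockSign_pull]
  refine Finset.prod_congr rfl fun z hz => Finset.prod_congr rfl fun w hw => ?_
  induction z with
  | bot => exact absurd hz hA
  | coe s =>
    induction w with
    | bot => exact absurd hw hB
    | coe t => exact blockSign_pull_coe_coe s t

theorem blockSign_pull_of_mem_left (hS : legSign (legOdd legs) Sᶜ = 1)
    {A B : Finset (WithBot {e // e ∈ S})} (hA : ⊥ ∈ A) (hB : ⊥ ∉ B) :
    blockSign (legOdd legs) (pull S A) (pull S B) =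
      blockSign (legOdd (subLegs legs S x)) A B * ∏ w ∈ B, crossSign legs S w := by
  have h : ∀ z ∈ A, ∀ w ∈ B, blockSign (legOdd legs) (pull S {z}) (pull S {w}) =
      pairSign (legOdd (subLegs legs S x)) z w * if z = ⊥ then crossSign legs S w else 1 := by
    intro z _ w hw
    induction w with
    | bot => exact absurd hw hB
    | coe t =>
      induction z with
      | bot => rw [if_pos rfl]; exact blockSign_pull_bot_coe hS t
      | coe s => rw [if_neg WithBot.coe_ne_bot, mul_one]; exact blockSign_pull_coe_coe s t
  rw [blockSign_pull, Finset.prod_congr rfl fun z hz => Finset.prod_congr rfl (h z hz)]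
  simp_rw [Finset.prod_mul_distrib]
  congr 1
  rw [Finset.prod_comm]
  refine Finset.prod_congr rfl fun w _ => ?_
  rw [Finset.prod_ite_eq', if_pos hA]

theorem blockSign_pull_of_mem_right (hx : x.odd = false)
    {A B : Finset (WithBot {e // e ∈ S})} (hA : ⊥ ∉ A) (hB : ⊥ ∈ B) :
    blockSign (legOdd legs) (pull S A) (pull S B) =
      blockSign (legOdd (subLegs legs S x)) A B * ∏ z ∈ A, crossSign legs S z := by
  have h : ∀ z ∈ A, ∀ w ∈ B, blockSign (legOdd legs) (pull S {z}) (pull S {w}) =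
      pairSign (legOdd (subLegs legs S x)) z w * if w = ⊥ then crossSign legs S z else 1 := by
    intro z hz w _
    induction z with
    | bot => exact absurd hz hA
    | coe s =>
      induction w with
      | bot => rw [if_pos rfl]; exact blockSign_pull_coe_bot hx s
      | coe t => rw [if_neg WithBot.coe_ne_bot, mul_one]; exact blockSign_pull_coe_coe s t
  rw [blockSign_pull, Finset.prod_congr rfl fun z hz => Finset.prod_congr rfl (h z hz)]
  simp_rw [Finset.prod_mul_distrib]
  congr 1
  refine Finset.prod_congr rfl fun z _ => ?_
  rw [Finset.prod_ite_eq', if_pos hB]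

theorem shuffleSign_pull (l : List (Finset (WithBot {e // e ∈ S}))) (hl : ∀ A ∈ l, ⊥ ∉ A) :
    shuffleSign (legOdd legs) (l.map (pull S)) =
      shuffleSign (legOdd (subLegs legs S x)) l := by
  induction l with
  | nil => rfl
  | cons A l ih =>
    rw [List.map_cons, shuffleSign_cons, shuffleSign_cons, ih fun B hB => hl B (by simp [hB]),
      List.map_map]
    congr 2
    exact List.map_congr_left fun B hB =>
      blockSign_pull_of_notMem (hl A (by simp)) (hl B (by simp [hB]))

theorem shuffleSign_pull_cons (hS : legSign (legOdd legs) Sᶜ = 1)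
    {A : Finset (WithBot {e // e ∈ S})} (hA : ⊥ ∈ A)
    (l : List (Finset (WithBot {e // e ∈ S}))) (hl : ∀ B ∈ l, ⊥ ∉ B) :
    shuffleSign (legOdd legs) ((A :: l).map (pull S)) =
      shuffleSign (legOdd (subLegs legs S x)) (A :: l) *
        (l.map fun B => ∏ w ∈ B, crossSign legs S w).prod := by
  rw [List.map_cons, shuffleSign_cons, shuffleSign_cons, shuffleSign_pull (x := x) l hl,
    List.map_map]
  have h : l.map (blockSign (legOdd legs) (pull S A) ∘ pull S) =
      l.map fun B => blockSign (legOdd (subLegs legs S x)) A B * ∏ w ∈ B, crossSign legs S w :=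
    List.map_congr_left fun B hB => blockSign_pull_of_mem_left hS hA (hl B hB)
  rw [h, List.prod_map_mul]
  ring

/-- List the block with ⊥ first. Replacing ⊥ by Sᶜ then changes only the inversions of this block
with the others, which gives the crossing signs of the half-lines that point away from ⊥. -/
theorem vertexValue_pull (hmom : ∑ e, (legs e).mom = 0) (hxm : x.mom = -momentum legs S)
    (hx : x.odd = false) (hS : legSign (legOdd legs) Sᶜ = 1) (hne : Sᶜ.Nonempty)
    {g : Finset E → Th.Comp} {v : Finset (Finset (WithBot {e // e ∈ S}))} (hv : IsPartition v)
    (hc : ∀ A ∈ v, paritySign (Th.parity (g (pull S A))) = legSign (legOdd legs) (pull S A)) :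
    Th.vertexValue legs g (v.image (pull S)).toList =
      Th.vertexValue (subLegs legs S x) (fun A => g (pull S A)) v.toList *
        ∏ A ∈ v, if ⊥ ∈ A then 1 else ∏ e ∈ A, crossSign legs S e := by
  obtain ⟨A, hA, hbot⟩ := hv.exists_mem ⊥
  have hrest : ∀ B ∈ v.erase A, ⊥ ∉ B := fun B hB h =>
    (Finset.mem_erase.1 hB).1 (hv.eq_of_mem (Finset.mem_of_mem_erase hB) hA h hbot)
  have hperm : (A :: (v.erase A).toList).Perm v.toList := by
    have h := Finset.toList_cons (Finset.notMem_erase A v)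
    rw [Finset.cons_eq_insert, Finset.insert_erase hA] at h
    exact h.symm
  have hperm' : ((A :: (v.erase A).toList).map (pull S)).Perm (v.image (pull S)).toList := by
    refine (List.perm_ext_iff_of_nodup ?_ (Finset.nodup_toList _)).2 fun B => ?_
    · exact (hperm.nodup_iff.2 v.nodup_toList).map (pull_injective hne)
    · rw [(hperm.map (pull S)).mem_iff]
      simp
  have hpar : paritySign x.odd = legSign (legOdd legs) Sᶜ := by rw [hS, hx]; simp [paritySign]
  have hc₁ : Th.Consistent (subLegs legs S x) v fun A => g (pull S A) := fun B hB => by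
    rw [legSign_subLegs hpar]
    exact hc B hB
  have hc₂ : Th.Consistent legs (v.image (pull S)) g := fun B hB => by
    obtain ⟨C, hC, rfl⟩ := Finset.mem_image.1 hB
    exact hc C hC
  rw [← vertexValue_perm legs ((isPartition_image_pull hne).2 hv) hc₂ hperm' (List.Perm.refl _),
    ← vertexValue_perm (subLegs legs S x) hv hc₁ hperm (List.Perm.refl _)]
  have hprod : (∏ B ∈ v, if ⊥ ∈ B then 1 else ∏ e ∈ B, crossSign legs S e) =
      ((v.erase A).toList.map fun B => ∏ w ∈ B, crossSign legs S w).prod := by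
    rw [← Finset.mul_prod_erase v _ hA, if_pos hbot, one_mul, Finset.prod_map_toList]
    exact Finset.prod_congr rfl fun B hB => if_neg (hrest B hB)
  unfold vertexValue
  rw [hprod, shuffleSign_pull_cons hS hbot _ fun B hB => hrest B (Finset.mem_toList.1 hB)]
  have hargs : ((A :: (v.erase A).toList).map (pull S)).map (fun A => (g A, momentum legs A)) =
      (A :: (v.erase A).toList).map
        fun A => (g (pull S A), momentum (subLegs legs S x) A) := by
    rw [List.map_map]
    exact List.map_congr_left fun B _ => by
      rw [momentum_subLegs hmom hxm]; rfl
  rw [hargs]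
  ring

end SubLegs

/-! ### Factorization of a single diagram -/

section Factorization

variable {G M : Type*} [Fintype M] [DecidableEq M] {Th : FeynmanRules G M}
variable {E : Type*} [Fintype E] [LinearOrder E] {S : Finset E} {legs : E → Th.Leg}

theorem lineValue_pull (hmom : ∑ e, (legs e).mom = 0) {x : Th.Leg}
    (hxm : x.mom = -momentum legs S) (hx : x.odd = false)
    (ξ : ℝ) (g : Finset E → Th.Comp)
    {T : Finset (Finset (Finset (WithBot {e // e ∈ S})))} {A : Finset (WithBot {e // e ∈ S})}
    (hA : A ∈ lines T) :
    lineValue ξ legs g (pull S A) =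
      lineValue ξ (subLegs legs S x) (fun A => g (pull S A)) A *
        ∏ e ∈ Aᶜ, crossSign legs S e := by
  have hbot := ((mem_lines_iff_of_le bot_le_withBot).1 hA).2.2
  unfold lineValue
  rw [momentum_subLegs hmom hxm, ← pull_compl,
    blockSign_pull_of_mem_right hx (by simpa using hbot) hbot]
  ring

/-- One side of a line, in terms of the subamplitude. -/
theorem treeTerm_subLegs (hmom : ∑ e, (legs e).mom = 0) {x : Th.Leg}
    (hxm : x.mom = -momentum legs S) (hx : x.odd = false)
    (hS : legSign (legOdd legs) Sᶜ = 1) (hne : Sᶜ.Nonempty) (ξ : ℝ) {g : Finset E → Th.Comp}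
    (hwave : x.wave (g Sᶜ) = 1)
    {T : Finset (Finset (Finset (WithBot {e // e ∈ S})))} (hT : IsTreeDiagram T)
    (hc : ∀ A ∈ T.biUnion id,
      paritySign (Th.parity (g (pull S A))) = legSign (legOdd legs) (pull S A)) :
    vertexProd legs (extendDiagram S T) g * (∏ A ∈ lines T, lineValue ξ legs g (pull S A)) *
        ∏ e ∈ S, (legs e).wave (g {e}) =
      treeTerm ξ (subLegs legs S x) T (fun A => g (pull S A)) *
        blockSign (legOdd legs) S Sᶜ := by
  have hV : vertexProd legs (extendDiagram S T) g =
      vertexProd (subLegs legs S x) T (fun A => g (pull S A)) *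
        ∏ v ∈ T, ∏ A ∈ v, if ⊥ ∈ A then 1 else ∏ e ∈ A, crossSign legs S e := by
    unfold vertexProd
    rw [extendDiagram_eq, Finset.prod_image fun v _ w _ h => image_pull_injective hne h,
      ← Finset.prod_mul_distrib]
    exact Finset.prod_congr rfl fun v hv => vertexValue_pull hmom hxm hx hS hne
      (hT.partition v hv) fun A hA => hc A (Finset.mem_biUnion.2 ⟨v, hv, hA⟩)
  have hL : ∏ A ∈ lines T, lineValue ξ legs g (pull S A) =
      (∏ A ∈ lines T, lineValue ξ (subLegs legs S x) (fun A => g (pull S A)) A) *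
        ∏ A ∈ lines T, ∏ e ∈ Aᶜ, crossSign legs S e := by
    rw [← Finset.prod_mul_distrib]
    exact Finset.prod_congr rfl fun A hA => lineValue_pull hmom hxm hx ξ g hA
  have hX : ∏ e ∈ S, (legs e).wave (g {e}) =
      waveProd (subLegs legs S x) fun A => g (pull S A) := by
    unfold waveProd
    rw [prod_withBot]
    simp only [pull_bot, subLegs_bot, hwave, one_mul, pull_coe, subLegs_coe]
    exact (Finset.prod_coe_sort S fun e => (legs e).wave (g {e})).symm
  -- The crossing signs collected at vertices and lines cancel except at the external legs, where
  -- they multiply to the sign of S against Sᶜ.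
  have hsign := prod_halfLines_mul_prod_lines bot_le_withBot hT
    (crossSign_mul_self (legs := legs) (S := S)) crossSign_bot
  rw [prod_crossSign] at hsign
  rw [hV, hL, hX, treeTerm, ← hsign]
  ring

/-- The value of a diagram with an unphysical propagator at the line `S`. -/
def markedTerm (ξ : ℝ) (legs : E → Th.Leg) (T : Finset (Finset (Finset E)))
    (g : Finset E → Th.Comp) (S : Finset E) : ℂ :=
  vertexProd legs T g * ((∏ A ∈ (lines T).erase S, lineValue ξ legs g A) *
    (blockSign (legOdd legs) Sᶜ S *
      Th.unphysicalPropagator ξ (momentum legs S) (g S) (g Sᶜ))) * waveProd legs g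

/-- The leg ⊥ of the first part stands for Sᶜ and so carries the label `g Sᶜ`, while that of the
second carries `g S`; hence the exchanged arguments of the symmetric unphysical propagator. -/
theorem markedTerm_join (hmom : ∑ e, (legs e).mom = 0) (h1 : S.Nonempty) (h2 : Sᶜ.Nonempty)
    (hmin : S.min < Sᶜ.min)
    {T₁ : Finset (Finset (Finset (WithBot {e // e ∈ S})))}
    {T₂ : Finset (Finset (Finset (WithBot {e // e ∈ Sᶜ})))}
    (hT₁ : IsTreeDiagram T₁) (hT₂ : IsTreeDiagram T₂) (ξ : ℝ) (g : Finset E → Th.Comp) :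
    markedTerm ξ legs (joinDiagrams S (T₁, T₂)) g S =
      blockSign (legOdd legs) S Sᶜ *
        (treeTerm ξ (subLegs legs S (Th.amputatedLeg (g Sᶜ) (-momentum legs S))) T₁
            (fun A => g (pull S A)) *
          Th.unphysicalPropagator ξ (momentum legs S) (g Sᶜ) (g S) *
          treeTerm ξ (subLegs legs Sᶜ (Th.amputatedLeg (g S) (-momentum legs Sᶜ))) T₂
            (fun A => g (pull Sᶜ A))) := by
  have h1' : Sᶜᶜ.Nonempty := by rwa [compl_compl]
  have hT := isTreeDiagram_join h1 h2 hT₁ hT₂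
  by_cases hD : Th.unphysicalPropagator ξ (momentum legs S) (g S) (g Sᶜ) = 0
  · unfold markedTerm
    rw [Th.unphysicalPropagator_symm ξ _ (g Sᶜ), hD]
    ring
  obtain ⟨hpS, hpSc⟩ := Th.unphysicalPropagator_parity _ _ _ _ hD
  have memS : S ∈ (joinDiagrams S (T₁, T₂)).biUnion id :=
    mem_biUnion_join.2 (Or.inr ⟨{⊥}, hT₂.singleton_mem ⊥, by rw [pull_bot, compl_compl]⟩)
  have memSc : Sᶜ ∈ (joinDiagrams S (T₁, T₂)).biUnion id :=
    mem_biUnion_join.2 (Or.inl ⟨{⊥}, hT₁.singleton_mem ⊥, pull_bot⟩)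
  have hlS : S ∈ lines (joinDiagrams S (T₁, T₂)) := mem_lines.2 ⟨memS, memSc, hmin⟩
  by_cases hc : Th.Consistent legs ((joinDiagrams S (T₁, T₂)).biUnion id) g
  · have hS : legSign (legOdd legs) S = 1 := by rw [← hc S memS, hpS]; simp [paritySign]
    have hSc : legSign (legOdd legs) Sᶜ = 1 := by rw [← hc Sᶜ memSc, hpSc]; simp [paritySign]
    have e₁ := treeTerm_subLegs hmom (x := Th.amputatedLeg (g Sᶜ) (-momentum legs S)) rfl hpSc hSc
      h2 ξ (if_pos rfl) hT₁ fun A hA => hc _ (mem_biUnion_join.2 (Or.inl ⟨A, hA, rfl⟩))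
    have e₂ := treeTerm_subLegs hmom (x := Th.amputatedLeg (g S) (-momentum legs Sᶜ)) rfl hpS
      (by rwa [compl_compl]) h1' ξ (if_pos (by rw [compl_compl])) hT₂
      fun A hA => hc _ (mem_biUnion_join.2 (Or.inr ⟨A, hA, rfl⟩))
    rw [compl_compl] at e₂
    have hV : vertexProd legs (joinDiagrams S (T₁, T₂)) g =
        vertexProd legs (extendDiagram S T₁) g * vertexProd legs (extendDiagram Sᶜ T₂) g :=
      Finset.prod_union (disjoint_extendDiagram h1 hT₁ hT₂)
    have hL := prod_lines_join h1 h2 hT₁ hT₂ hlS (F := lineValue ξ legs g) fun A hA =>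
      lineValue_compl hmom (hc A (mem_lines.1 hA).1) (hc Aᶜ (mem_lines.1 hA).2.1)
    have hX : waveProd legs g =
        (∏ e ∈ S, (legs e).wave (g {e})) * ∏ e ∈ Sᶜ, (legs e).wave (g {e}) :=
      (Finset.prod_mul_prod_compl S _).symm
    have hsq := blockSign_mul_self (legOdd legs) Sᶜ S
    unfold markedTerm
    rw [hV, hL, hX, Th.unphysicalPropagator_symm ξ _ (g Sᶜ)]
    generalize treeTerm ξ (subLegs legs S _) T₁ _ = t₁ at *
    generalize treeTerm ξ (subLegs legs Sᶜ _) T₂ _ = t₂ at *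
    generalize vertexProd legs (extendDiagram S T₁) g = v₁ at *
    generalize vertexProd legs (extendDiagram Sᶜ T₂) g = v₂ at *
    generalize (∏ A ∈ lines T₁, lineValue ξ legs g (pull S A)) = l₁ at *
    generalize (∏ A ∈ lines T₂, lineValue ξ legs g (pull Sᶜ A)) = l₂ at *
    generalize (∏ e ∈ S, (legs e).wave (g {e})) = x₁ at *
    generalize (∏ e ∈ Sᶜ, (legs e).wave (g {e})) = x₂ at *
    generalize blockSign (legOdd legs) Sᶜ S = b at *
    generalize blockSign (legOdd legs) S Sᶜ = b' at *
    generalize Th.unphysicalPropagator ξ (momentum legs S) (g S) (g Sᶜ) = D at *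
    -- The two parts contribute the signs `b'` and `b`; the latter cancels against the sign `b` of
    -- the marked line.
    linear_combination (b * D * v₂ * l₂ * x₂) * e₁ + (b * D * t₁ * b') * e₂ +
      (D * t₁ * b' * t₂) * hsq
  -- For inconsistent labels both sides vanish: nonzero factors on the right would make S and Sᶜ
  -- even and both parts consistent, and these two properties glue to consistency of the whole.
  · have hl : markedTerm ξ legs (joinDiagrams S (T₁, T₂)) g S = 0 := by
      by_contra hne
      have hne' := left_ne_zero_of_mul hne
      refine hc (consistent_of_conserved legs hT
        (prod_paritySign_of_vertexProd_ne_zero (left_ne_zero_of_mul hne'))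
        (fun A hA hA' => parity_of_lines hT (fun B hB => ?_) hA hA')
        (parity_of_waveProd_ne_zero (right_ne_zero_of_mul hne)))
      by_cases hBS : B = S
      · rw [hBS, hpS, hpSc]
      · have hp := left_ne_zero_of_mul (right_ne_zero_of_mul hne')
        exact Th.propagator_parity ξ _ _ _ (right_ne_zero_of_mul
          (Finset.prod_ne_zero_iff.1 hp B (Finset.mem_erase.2 ⟨hBS, hB⟩)))
    rw [hl]
    symm
    by_contra hne
    have hne' := right_ne_zero_of_mul hne
    obtain ⟨c₁, u₁⟩ := treeTerm_ne_zero hT₁ (left_ne_zero_of_mul (left_ne_zero_of_mul hne'))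
    obtain ⟨c₂, u₂⟩ := treeTerm_ne_zero hT₂ (right_ne_zero_of_mul hne')
    have o₁ : (Th.amputatedLeg (g Sᶜ) (-momentum legs S)).odd = false := hpSc
    have o₂ : (Th.amputatedLeg (g S) (-momentum legs Sᶜ)).odd = false := hpS
    have one : paritySign false = 1 := by simp [paritySign]
    rw [legSign_subLegs_univ, o₁, one, one_mul] at u₁
    rw [legSign_subLegs_univ, o₂, one, one_mul] at u₂
    refine hc fun A hA => ?_
    rcases mem_biUnion_join.1 hA with ⟨B, hB, rfl⟩ | ⟨B, hB, rfl⟩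
    · rw [← legSign_subLegs (x := Th.amputatedLeg (g Sᶜ) (-momentum legs S)) (by
        rw [o₁, one, u₂])]
      exact c₁ B hB
    · rw [← legSign_subLegs (x := Th.amputatedLeg (g S) (-momentum legs Sᶜ)) (by
        rw [o₂, one, compl_compl, u₁])]
      exact c₂ B hB

end Factorization

end FeynmanRules

end RxiGauge

end

noncomputable section

namespace RxiGauge

namespace FeynmanRules

/-! ### The derivative of the amplitude -/

section Derivative

variable {G M : Type*} [Fintype M] [DecidableEq M] {Th : FeynmanRules G M}
variable {E : Type*} [Fintype E] [LinearOrder E] {legs : E → Th.Leg}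

/-- For the gauge boson the derivative of the bracket is proportional to p² - m², which cancels the
prefactor 1/(p² - m²). -/
theorem hasDerivAt_propagator {ξ₀ : ℝ} {p : Momentum}
    (hp : ∀ a, msq p ≠ Th.mass a ^ 2 ∧ msq p ≠ ξ₀ * Th.mass a ^ 2) (c c' : Th.Comp) :
    HasDerivAt (fun ξ : ℝ => Th.propagator ξ p c c') (Th.unphysicalPropagator ξ₀ p c c') ξ₀ := by
  have hden : ∀ a, HasDerivAt (fun ξ : ℝ => msq p - ξ * Th.mass a ^ 2) (-(Th.mass a ^ 2)) ξ₀ :=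
    fun a => by simpa using ((hasDerivAt_id ξ₀).mul_const (Th.mass a ^ 2)).const_sub (msq p)
  have hne : ∀ a, msq p - ξ₀ * Th.mass a ^ 2 ≠ 0 := fun a => sub_ne_zero.2 (hp a).2
  have hne' : ∀ a, msq p - Th.mass a ^ 2 ≠ 0 := fun a => sub_ne_zero.2 (hp a).1
  rcases c with ⟨a, μ⟩ | ⟨a, ha⟩ | i <;> rcases c' with ⟨b, ν⟩ | ⟨b, hb⟩ | j <;>
    simp only [propagator, unphysicalPropagator] <;> try exact hasDerivAt_const _ _
  · by_cases h : a = b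
    · subst h
      simp only [if_true]
      have h1 : HasDerivAt (fun ξ : ℝ => metric μ ν -
          (1 - ξ) * (p μ * p ν) / (msq p - ξ * Th.mass a ^ 2))
          (p μ * p ν * (msq p - Th.mass a ^ 2) / (msq p - ξ₀ * Th.mass a ^ 2) ^ 2) ξ₀ := by
        have h2 := (((hasDerivAt_id ξ₀).const_sub 1).mul_const (p μ * p ν)).div (hden a) (hne a)
        refine (h2.const_sub (metric μ ν)).congr_deriv ?_
        have := hne a
        simp only [id]
        field_simp
        ring
      refine (h1.ofReal_comp.const_mul _).congr_deriv ?_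
      have e1 : ((msq p : ℂ) - (ξ₀ : ℂ) * (Th.mass a : ℂ) ^ 2) ≠ 0 := by exact_mod_cast hne a
      have e2 : ((msq p : ℂ) - (Th.mass a : ℂ) ^ 2) ≠ 0 := by exact_mod_cast hne' a
      push_cast
      field_simp
    · simp only [if_neg h]
      exact hasDerivAt_const _ _
  · by_cases h : a = b
    · subst h
      simp only [if_true]
      have e1 : (((msq p - ξ₀ * Th.mass a ^ 2 : ℝ) : ℂ)) ≠ 0 := by exact_mod_cast hne a
      refine ((hasDerivAt_const ξ₀ Complex.I).div (hden a).ofReal_comp e1).congr_deriv ?_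
      push_cast
      ring
    · simp only [if_neg h]
      exact hasDerivAt_const _ _

theorem hasDerivAt_treeTerm {ξ₀ : ℝ} (hξ : Th.NonSingular ξ₀ legs)
    {T : Finset (Finset (Finset E))} (hT : IsTreeDiagram T) (g : Finset E → Th.Comp) :
    HasDerivAt (fun ξ : ℝ => treeTerm ξ legs T g)
      (∑ S ∈ lines T, markedTerm ξ₀ legs T g S) ξ₀ := by
  have hl : ∀ A ∈ lines T, HasDerivAt (fun ξ : ℝ => lineValue ξ legs g A)
      (blockSign (legOdd legs) Aᶜ A *
        Th.unphysicalPropagator ξ₀ (momentum legs A) (g A) (g Aᶜ)) ξ₀ := fun A hA =>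
    (hasDerivAt_propagator (hξ A (two_le_card_of_mem_lines hT hA).1
      (two_le_card_of_mem_lines hT hA).2).1 _ _).const_mul _
  have h := ((HasDerivAt.fun_finsetProd hl).const_mul (vertexProd legs T g)).mul_const
    (waveProd legs g)
  refine h.congr_deriv ?_
  rw [Finset.mul_sum, Finset.sum_mul]
  rfl

end Derivative

/-! ### Labels of a joined diagram -/

section Labels

variable {E C : Type*} [Fintype E] [LinearOrder E] {T : Finset (Finset (Finset E))}

/-- Extend labels on the half-lines of a diagram to all sets of legs. -/
def extendLabels (hT : (T.biUnion id).Nonempty) (f : HalfLine T → C) (A : Finset E) : C :=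
  -- Values off the half-lines are never used; an existing label serves as default because C might
  -- be empty.
  if h : A ∈ T.biUnion id then f ⟨A, h⟩ else f ⟨hT.choose, hT.choose_spec⟩

theorem extendLabels_val (hT : (T.biUnion id).Nonempty) (f : HalfLine T → C) (h : HalfLine T) :
    extendLabels hT f h.1 = f h := dif_pos h.2

variable {S : Finset E}
  {T₁ : Finset (Finset (Finset (WithBot {e // e ∈ S})))}
  {T₂ : Finset (Finset (Finset (WithBot {e // e ∈ Sᶜ})))}

/-- The half-lines of a diagram that is joined from two. -/
def joinHalfLines (S : Finset E) (T₁ : Finset (Finset (Finset (WithBot {e // e ∈ S}))))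
    (T₂ : Finset (Finset (Finset (WithBot {e // e ∈ Sᶜ})))) :
    HalfLine T₁ ⊕ HalfLine T₂ → HalfLine (joinDiagrams S (T₁, T₂)) :=
  Sum.elim (fun h => ⟨pull S h.1, mem_biUnion_join.2 (Or.inl ⟨h.1, h.2, rfl⟩)⟩)
    fun h => ⟨pull Sᶜ h.1, mem_biUnion_join.2 (Or.inr ⟨h.1, h.2, rfl⟩)⟩

/-- A common half-line would belong to a single vertex of the joined diagram, lying on both sides of
the cut. -/
theorem pull_ne_pull (h1 : S.Nonempty) (h2 : Sᶜ.Nonempty) (hT₁ : IsTreeDiagram T₁)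
    (hT₂ : IsTreeDiagram T₂) {A : Finset (WithBot {e // e ∈ S})} (hA : A ∈ T₁.biUnion id)
    {B : Finset (WithBot {e // e ∈ Sᶜ})} (hB : B ∈ T₂.biUnion id) : pull S A ≠ pull Sᶜ B := by
  intro h
  obtain ⟨v, hv, hAv⟩ := Finset.mem_biUnion.1 hA
  obtain ⟨w, hw, hBw⟩ := Finset.mem_biUnion.1 hB
  have hv' : v.image (pull S) ∈ extendDiagram S T₁ := mem_extendDiagram.2 ⟨v, hv, rfl⟩
  have hw' : w.image (pull Sᶜ) ∈ extendDiagram Sᶜ T₂ := mem_extendDiagram.2 ⟨w, hw, rfl⟩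
  have heq : v.image (pull S) = w.image (pull Sᶜ) :=
    (isTreeDiagram_join h1 h2 hT₁ hT₂).vertex_unique (Finset.mem_union_left _ hv')
      (Finset.mem_union_right _ hw') (Finset.mem_image_of_mem _ hAv)
      (h ▸ Finset.mem_image_of_mem _ hBw)
  exact Finset.disjoint_left.1 (disjoint_extendDiagram h1 hT₁ hT₂) hv' (heq ▸ hw')

theorem joinHalfLines_bijective (h1 : S.Nonempty) (h2 : Sᶜ.Nonempty) (hT₁ : IsTreeDiagram T₁)
    (hT₂ : IsTreeDiagram T₂) : Function.Bijective (joinHalfLines S T₁ T₂) := by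
  have h1' : Sᶜᶜ.Nonempty := by rwa [compl_compl]
  constructor
  · rintro (⟨A, hA⟩ | ⟨A, hA⟩) (⟨B, hB⟩ | ⟨B, hB⟩) h <;> have h' := congrArg Subtype.val h
    · have := pull_injective h2 h'
      subst this; rfl
    · exact absurd h' (pull_ne_pull h1 h2 hT₁ hT₂ hA hB)
    · exact absurd h'.symm (pull_ne_pull h1 h2 hT₁ hT₂ hB hA)
    · have := pull_injective h1' h'
      subst this; rfl
  · rintro ⟨A, hA⟩
    rcases mem_biUnion_join.1 hA with ⟨B, hB, rfl⟩ | ⟨B, hB, rfl⟩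
    · exact ⟨Sum.inl ⟨B, hB⟩, rfl⟩
    · exact ⟨Sum.inr ⟨B, hB⟩, rfl⟩

end Labels

section Sums

theorem sum_sum_mul_mul {C X Y : Type*} [Fintype C] (s : Finset X) (t : Finset Y) (u : C → X → ℂ)
    (D : C → C → ℂ) (w : C → Y → ℂ) :
    ∑ c, ∑ c', (∑ x ∈ s, u c x) * D c c' * (∑ y ∈ t, w c' y) =
      ∑ p ∈ s ×ˢ t, ∑ c, ∑ c', u c p.1 * D c c' * w c' p.2 := by
  rw [Finset.sum_comm (s := s ×ˢ t)]
  refine Finset.sum_congr rfl fun c _ => ?_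
  rw [Finset.sum_comm (s := s ×ˢ t)]
  refine Finset.sum_congr rfl fun c' _ => ?_
  rw [Finset.sum_mul, Finset.sum_mul_sum, ← Finset.sum_product']

theorem sum_sum_eq_of_support {C : Type*} [Fintype C] (u w : C → ℂ) (D : C → C → ℂ)
    {k k' : C} (hu : ∀ c, c ≠ k → u c = 0) (hw : ∀ c, c ≠ k' → w c = 0) :
    ∑ c, ∑ c', u c * D c c' * w c' = u k * D k k' * w k' := by
  rw [Fintype.sum_eq_single k fun c hc => by simp [hu c hc],
    Fintype.sum_eq_single k' fun c hc => by simp [hw c hc]]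

end Sums

/-! ### Summation over labels and diagrams -/

section Factorize

variable {G M : Type*} [Fintype G] [Fintype M] [DecidableEq M] {Th : FeynmanRules G M}
variable {E : Type*} [Fintype E] [LinearOrder E] {legs : E → Th.Leg} {S : Finset E}

theorem diagramTerm_amputated_eq_zero (ξ : ℝ) {T : Finset (Finset (Finset (WithBot {e // e ∈ S})))}
    (hT : IsTreeDiagram T) (f : HalfLine T → Th.Comp) (c : Th.Comp) (k : Momentum)
    (hc : c ≠ f ⟨{⊥}, hT.singleton_mem ⊥⟩) :
    Th.diagramTerm ξ (subLegs legs S (Th.amputatedLeg c k)) T f = 0 := by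
  unfold diagramTerm
  refine mul_eq_zero_of_right _ (Finset.prod_eq_zero
    (i := (⊥, ⟨{⊥}, hT.singleton_mem ⊥⟩)) (Finset.mem_filter.2 ⟨Finset.mem_univ _, rfl⟩) ?_)
  exact if_neg (Ne.symm hc)

/-- The sum over the labels of a diagram with an unphysical propagator at the line `S`. -/
def markedSum (ξ : ℝ) (legs : E → Th.Leg) (T : Finset (Finset (Finset E))) (S : Finset E) : ℂ :=
  ∑ f : HalfLine T → Th.Comp,
    if h : (T.biUnion id).Nonempty then markedTerm ξ legs T (extendLabels h f) S else 0

theorem markedSum_join (hmom : ∑ e, (legs e).mom = 0) (h1 : S.Nonempty) (h2 : Sᶜ.Nonempty)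
    (hmin : S.min < Sᶜ.min)
    {T₁ : Finset (Finset (Finset (WithBot {e // e ∈ S})))}
    {T₂ : Finset (Finset (Finset (WithBot {e // e ∈ Sᶜ})))}
    (hT₁ : IsTreeDiagram T₁) (hT₂ : IsTreeDiagram T₂) (ξ : ℝ) :
    markedSum ξ legs (joinDiagrams S (T₁, T₂)) S = blockSign (legOdd legs) S Sᶜ *
      ∑ c, ∑ c',
        (∑ f : HalfLine T₁ → Th.Comp,
          Th.diagramTerm ξ (subLegs legs S (Th.amputatedLeg c (-momentum legs S))) T₁ f) *
        Th.unphysicalPropagator ξ (momentum legs S) c c' *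
        ∑ f : HalfLine T₂ → Th.Comp,
          Th.diagramTerm ξ (subLegs legs Sᶜ (Th.amputatedLeg c' (-momentum legs Sᶜ))) T₂ f := by
  have hT := isTreeDiagram_join h1 h2 hT₁ hT₂
  rw [sum_sum_mul_mul, Finset.mul_sum, Finset.univ_product_univ]
  refine Fintype.sum_equiv (((Equiv.ofBijective _
    (joinHalfLines_bijective h1 h2 hT₁ hT₂)).symm.arrowCongr (Equiv.refl Th.Comp)).trans
      (Equiv.sumArrowEquivProdArrow _ _ _)) _ _ fun f => ?_
  rw [dif_pos hT.biUnion_nonempty]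
  set g := extendLabels hT.biUnion_nonempty f with hg
  have hf₁ : (fun h : HalfLine T₁ => f (joinHalfLines S T₁ T₂ (Sum.inl h))) =
      fun h => g (pull S h.1) := funext fun h => (extendLabels_val _ f _).symm
  have hf₂ : (fun h : HalfLine T₂ => f (joinHalfLines S T₁ T₂ (Sum.inr h))) =
      fun h => g (pull Sᶜ h.1) := funext fun h => (extendLabels_val _ f _).symm
  have hp : ((((Equiv.ofBijective _
      (joinHalfLines_bijective h1 h2 hT₁ hT₂)).symm.arrowCongr (Equiv.refl Th.Comp)).trans
      (Equiv.sumArrowEquivProdArrow _ _ _)) f) =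
      ((fun h : HalfLine T₁ => g (pull S h.1)), fun h : HalfLine T₂ => g (pull Sᶜ h.1)) :=
    Prod.ext hf₁ hf₂
  -- The wave function of an amputated leg is a delta, so the sums over c and c' collapse to the
  -- labels at the two legs ⊥.
  rw [hp, sum_sum_eq_of_support (k := g Sᶜ) (k' := g S), markedTerm_join hmom h1 h2 hmin hT₁ hT₂]
  · dsimp only
    rw [← diagramTerm_eq_treeTerm ξ _ hT₁ fun A => g (pull S A),
      ← diagramTerm_eq_treeTerm ξ _ hT₂ fun A => g (pull Sᶜ A)]
  · intro c hc
    exact diagramTerm_amputated_eq_zero ξ hT₁ _ c _ (by dsimp only; rwa [pull_bot])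
  · intro c hc
    exact diagramTerm_amputated_eq_zero ξ hT₂ _ c _ (by dsimp only; rwa [pull_bot, compl_compl])

theorem mem_treeDiagrams {T : Finset (Finset (Finset E))} :
    T ∈ treeDiagrams E ↔ IsTreeDiagram T := by
  simp [treeDiagrams]

theorem hasLine_iff {T : Finset (Finset (Finset E))} :
    HasLine T S ↔ S ∈ T.biUnion id ∧ Sᶜ ∈ T.biUnion id := by
  simp [HasLine]

theorem sum_markedSum (hmom : ∑ e, (legs e).mom = 0) (ξ : ℝ) :
    ∑ T ∈ treeDiagrams E, ∑ S ∈ lines T, markedSum ξ legs T S = Th.unphysicalExchange ξ legs := by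
  classical
  -- Sum first over the marked splitting, then over the diagrams that have this line.
  rw [Finset.sum_comm' (t' := splittings E) (s' := fun S => (treeDiagrams E).filter (HasLine · S))]
  · unfold unphysicalExchange
    refine Finset.sum_congr rfl fun S hS => ?_
    obtain ⟨hS2, hSc2, hmin⟩ := (Finset.mem_filter.1 hS).2
    have h1 : S.Nonempty := Finset.card_pos.1 (by omega)
    have h2 : Sᶜ.Nonempty := Finset.card_pos.1 (by omega)
    obtain ⟨hmaps, hinj, hsurj⟩ := bijOn_joinDiagrams h1 h2
    have h := Finset.sum_nbij (s := treeDiagrams _ ×ˢ treeDiagrams _)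
      (t := (treeDiagrams E).filter (HasLine · S)) (joinDiagrams S)
      (f := fun p => markedSum ξ legs (joinDiagrams S p) S) (g := fun T => markedSum ξ legs T S)
      (fun p hp => ?_) (fun p hp q hq h => ?_) (fun T hT => ?_) (fun _ _ => rfl)
    · rw [← h, shuffleSign_pair]
      unfold subAmplitude amplitude
      rw [sum_sum_mul_mul, Finset.mul_sum]
      refine Finset.sum_congr rfl fun p hp => ?_
      obtain ⟨hp1, hp2⟩ := Finset.mem_product.1 hp
      rw [mem_treeDiagrams] at hp1 hp2
      exact markedSum_join hmom h1 h2 hmin hp1 hp2 ξ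
    · obtain ⟨hp1, hp2⟩ := Finset.mem_product.1 hp
      rw [mem_treeDiagrams] at hp1 hp2
      obtain ⟨ht, hl⟩ := hmaps (show p ∈ {T | IsTreeDiagram T.1 ∧ IsTreeDiagram T.2} from
        ⟨hp1, hp2⟩)
      exact Finset.mem_filter.2 ⟨mem_treeDiagrams.2 ht, hl⟩
    · obtain ⟨hp1, hp2⟩ := Finset.mem_product.1 hp
      obtain ⟨hq1, hq2⟩ := Finset.mem_product.1 hq
      rw [mem_treeDiagrams] at hp1 hp2 hq1 hq2
      exact hinj ⟨hp1, hp2⟩ ⟨hq1, hq2⟩ h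
    · obtain ⟨ht, hl⟩ := Finset.mem_filter.1 hT
      obtain ⟨p, ⟨hp1, hp2⟩, hp⟩ := hsurj ⟨mem_treeDiagrams.1 ht, hl⟩
      exact ⟨p, Finset.mem_product.2 ⟨mem_treeDiagrams.2 hp1, mem_treeDiagrams.2 hp2⟩, hp⟩
  · intro T S
    rw [mem_lines, Finset.mem_filter, splittings, Finset.mem_filter, hasLine_iff]
    constructor
    · rintro ⟨hT, h1, h2, hmin⟩
      have hc := two_le_card_of_mem_lines (mem_treeDiagrams.1 hT) (mem_lines.2 ⟨h1, h2, hmin⟩)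
      exact ⟨⟨hT, h1, h2⟩, Finset.mem_univ _, hc.1, hc.2, hmin⟩
    · rintro ⟨⟨hT, h1, h2⟩, -, -, -, hmin⟩
      exact ⟨hT, h1, h2, hmin⟩

theorem hasDerivAt_amplitude (hmom : ∑ e, (legs e).mom = 0) {ξ₀ : ℝ}
    (hξ : Th.NonSingular ξ₀ legs) :
    HasDerivAt (fun ξ : ℝ => Th.amplitude ξ legs) (Th.unphysicalExchange ξ₀ legs) ξ₀ := by
  rw [← sum_markedSum hmom]
  unfold amplitude
  refine HasDerivAt.fun_sum fun T hT => ?_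
  have hT' := mem_treeDiagrams.1 hT
  unfold markedSum
  rw [Finset.sum_comm]
  refine (HasDerivAt.fun_sum (A' := fun f =>
    ∑ S ∈ lines T, markedTerm ξ₀ legs T (extendLabels hT'.biUnion_nonempty f) S)
      fun f _ => ?_).congr_deriv ?_
  · have hf : f = fun h => extendLabels hT'.biUnion_nonempty f h.1 :=
      funext fun h => (extendLabels_val _ f h).symm
    have h := hasDerivAt_treeTerm hξ hT' (extendLabels hT'.biUnion_nonempty f)
    simp_rw [← diagramTerm_eq_treeTerm _ legs hT', ← hf] at h
    exact h
  · have : ∀ f : HalfLine T → Th.Comp, (∑ S ∈ lines T, if h : (T.biUnion id).Nonempty then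
        markedTerm ξ₀ legs T (extendLabels h f) S else 0) =
        ∑ S ∈ lines T, markedTerm ξ₀ legs T (extendLabels hT'.biUnion_nonempty f) S :=
      fun f => Finset.sum_congr rfl fun S _ => dif_pos hT'.biUnion_nonempty
    simp_rw [this]

end Factorize

end FeynmanRules

end RxiGauge

end

noncomputable section

namespace RxiGauge

namespace FeynmanRules

/-! ### Ward identities -/

section Ward

variable {G M : Type*} [Fintype G] [Fintype M] [DecidableEq M] {Th : FeynmanRules G M}

theorem sum_comp (φ : Th.Comp → ℂ) :
    ∑ c, φ c = (∑ a, ∑ μ, φ (.gauge a μ)) +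
      ((∑ a : {a : G // Th.mass a ≠ 0}, φ (.goldstone a.1 a.2)) + ∑ i, φ (.matter i)) := by
  rw [← (Component.equivSum Th.mass M).sum_comp, Fintype.sum_sum_type, Fintype.sum_sum_type,
    Fintype.sum_prod_type]
  rfl

open Classical in
/-- A sum over components against the unphysical propagator. -/
theorem sum_unphysicalPropagator (ξ : ℝ) (p : Momentum) (u w : Th.Comp → ℂ) :
    ∑ c, ∑ c', u c * Th.unphysicalPropagator ξ p c c' * w c' =
      ∑ a, Complex.I / (((msq p - ξ * Th.mass a ^ 2) ^ 2 : ℝ) : ℂ) *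
        ((if h : Th.mass a ≠ 0 then
            (Th.mass a * u (.goldstone a h)) * (Th.mass a * w (.goldstone a h)) else 0) -
          (∑ μ, (p μ : ℂ) * u (.gauge a μ)) * ∑ ν, (p ν : ℂ) * w (.gauge a ν)) := by
  have h1 : ∀ a μ, ∑ c', u (.gauge a μ) * Th.unphysicalPropagator ξ p (.gauge a μ) c' * w c' =
      -(Complex.I / (((msq p - ξ * Th.mass a ^ 2) ^ 2 : ℝ) : ℂ)) *
        ((p μ : ℂ) * u (.gauge a μ)) * ∑ ν, (p ν : ℂ) * w (.gauge a ν) := by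
    intro a μ
    rw [sum_comp, Fintype.sum_eq_single a]
    · simp only [unphysicalPropagator, if_true, mul_zero, zero_mul, Finset.sum_const_zero,
        add_zero, Finset.mul_sum]
      refine Finset.sum_congr rfl fun ν _ => ?_
      push_cast
      ring
    · intro b hb
      simp [unphysicalPropagator, Ne.symm hb]
  have h2 : ∀ a h, ∑ c', u (.goldstone a h) *
      Th.unphysicalPropagator ξ p (.goldstone a h) c' * w c' =
      Complex.I / (((msq p - ξ * Th.mass a ^ 2) ^ 2 : ℝ) : ℂ) *
        ((Th.mass a * u (.goldstone a h)) * (Th.mass a * w (.goldstone a h))) := by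
    intro a h
    rw [sum_comp, Fintype.sum_eq_single (⟨a, h⟩ : {a : G // Th.mass a ≠ 0})]
    · simp only [unphysicalPropagator, if_true, mul_zero, zero_mul, Finset.sum_const_zero,
        add_zero, zero_add]
      push_cast
      ring
    · intro b hb
      have : a ≠ b.1 := fun h => hb (Subtype.ext h.symm)
      simp [unphysicalPropagator, this]
  have h3 : ∀ i, ∑ c', u (.matter i) * Th.unphysicalPropagator ξ p (.matter i) c' * w c' = 0 := by
    intro i
    refine Finset.sum_eq_zero fun c' _ => ?_
    cases c' <;> simp [unphysicalPropagator]
  rw [sum_comp]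
  simp only [h1, h2, h3, Finset.sum_const_zero, add_zero, ← Finset.sum_mul, ← Finset.mul_sum]
  -- Extend the Goldstone sum by zero to the massless gauge bosons, to combine it with the gauge
  -- boson sum.
  have h4 : ∑ a : {a : G // Th.mass a ≠ 0},
      Complex.I / (((msq p - ξ * Th.mass a.1 ^ 2) ^ 2 : ℝ) : ℂ) *
        ((Th.mass a.1 * u (.goldstone a.1 a.2)) * (Th.mass a.1 * w (.goldstone a.1 a.2))) =
      ∑ a, Complex.I / (((msq p - ξ * Th.mass a ^ 2) ^ 2 : ℝ) : ℂ) *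
        (if h : Th.mass a ≠ 0 then
          (Th.mass a * u (.goldstone a h)) * (Th.mass a * w (.goldstone a h)) else 0) := by
    symm
    rw [← Finset.sum_subset (Finset.filter_subset (fun a => Th.mass a ≠ 0) Finset.univ),
      ← Finset.sum_subtype_eq_sum_filter]
    · refine Finset.sum_congr (by ext; simp) fun a _ => ?_
      rw [dif_pos a.2]
    · intro a _ ha
      have : ¬ Th.mass a ≠ 0 := fun h => ha (Finset.mem_filter.2 ⟨Finset.mem_univ _, h⟩)
      rw [dif_neg this, mul_zero]
  rw [h4, ← Finset.sum_add_distrib]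
  refine Finset.sum_congr rfl fun a _ => ?_
  ring

variable {E : Type*} [Fintype E] [LinearOrder E] {legs : E → Th.Leg}

/-- By the Ward identities, the exchange of unphysical gauge bosons and of Goldstone bosons
cancel. -/
theorem unphysicalExchange_eq_zero (hmom : ∑ e, (legs e).mom = 0) {ξ : ℝ}
    (hW : Th.SubWardIdentities ξ legs) : Th.unphysicalExchange ξ legs = 0 := by
  refine Finset.sum_eq_zero fun S hS => mul_eq_zero_of_right _ ?_
  obtain ⟨h1, h2, -⟩ := (Finset.mem_filter.1 hS).2
  rw [sum_unphysicalPropagator]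
  refine Finset.sum_eq_zero fun a _ => mul_eq_zero_of_right _ ?_
  have w₁ := hW S h1 h2 a
  have w₂ := hW Sᶜ h2 (by rwa [compl_compl]) a
  -- The extra leg has k = -P on the side S and k = P on the side Sᶜ. The factors of the two Ward
  -- identities are then i and -i, with product 1.
  rw [momentum_compl hmom, neg_neg] at w₂
  simp only [Pi.neg_apply, Complex.ofReal_neg, neg_mul, Finset.sum_neg_distrib, mul_neg,
    neg_neg] at w₁ w₂
  by_cases h : Th.mass a ≠ 0
  · rw [dif_pos h] at w₁ w₂ ⊢
    rw [← w₁, ← w₂]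
    linear_combination -((∑ μ, (momentum legs S μ : ℂ) * Th.subAmplitude ξ legs S (.gauge a μ)) *
      ∑ μ, (momentum legs S μ : ℂ) * Th.subAmplitude ξ legs Sᶜ (.gauge a μ)) * Complex.I_mul_I
  -- In the massless case one vanishing contraction suffices.
  · rw [dif_neg h] at w₁ ⊢
    rw [(mul_eq_zero.1 w₁).resolve_left Complex.I_ne_zero]
    ring

end Ward

/-! ### The amplitude is a rational function of the gauge parameter -/

open Polynomial in
/-- `f` agrees on `U` with a rational function without poles in `U`. -/
def IsRationalOn (U : Set ℝ) (f : ℝ → ℂ) : Prop :=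
  ∃ P Q : ℂ[X], ∀ ξ ∈ U, Q.eval (ξ : ℂ) ≠ 0 ∧ f ξ = P.eval (ξ : ℂ) / Q.eval (ξ : ℂ)

namespace IsRationalOn

variable {U : Set ℝ}

theorem congr {f g : ℝ → ℂ} (hf : IsRationalOn U f) (h : ∀ ξ ∈ U, g ξ = f ξ) :
    IsRationalOn U g := by
  obtain ⟨P, Q, hPQ⟩ := hf
  exact ⟨P, Q, fun ξ hξ => ⟨(hPQ ξ hξ).1, (h ξ hξ).trans (hPQ ξ hξ).2⟩⟩

theorem const (c : ℂ) : IsRationalOn U fun _ => c :=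
  ⟨Polynomial.C c, 1, fun ξ _ => by simp⟩

theorem ofReal : IsRationalOn U fun ξ => (ξ : ℂ) :=
  ⟨Polynomial.X, 1, fun ξ _ => by simp⟩

theorem add {f g : ℝ → ℂ} (hf : IsRationalOn U f) (hg : IsRationalOn U g) :
    IsRationalOn U fun ξ => f ξ + g ξ := by
  obtain ⟨P, Q, h⟩ := hf
  obtain ⟨P', Q', h'⟩ := hg
  refine ⟨P * Q' + Q * P', Q * Q', fun ξ hξ => ?_⟩
  obtain ⟨h1, h2⟩ := h ξ hξ
  obtain ⟨h1', h2'⟩ := h' ξ hξ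
  refine ⟨by simpa using ⟨h1, h1'⟩, ?_⟩
  simp only [h2, h2', Polynomial.eval_add, Polynomial.eval_mul]
  exact div_add_div _ _ h1 h1'

theorem mul {f g : ℝ → ℂ} (hf : IsRationalOn U f) (hg : IsRationalOn U g) :
    IsRationalOn U fun ξ => f ξ * g ξ := by
  obtain ⟨P, Q, h⟩ := hf
  obtain ⟨P', Q', h'⟩ := hg
  refine ⟨P * P', Q * Q', fun ξ hξ => ?_⟩
  obtain ⟨h1, h2⟩ := h ξ hξ
  obtain ⟨h1', h2'⟩ := h' ξ hξ
  refine ⟨by simpa using ⟨h1, h1'⟩, ?_⟩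
  simp only [h2, h2', Polynomial.eval_mul]
  exact div_mul_div_comm _ _ _ _

theorem inv {f : ℝ → ℂ} (hf : IsRationalOn U f) (h0 : ∀ ξ ∈ U, f ξ ≠ 0) :
    IsRationalOn U fun ξ => (f ξ)⁻¹ := by
  obtain ⟨P, Q, h⟩ := hf
  refine ⟨Q, P, fun ξ hξ => ?_⟩
  obtain ⟨h1, h2⟩ := h ξ hξ
  refine ⟨fun hP => h0 ξ hξ (by rw [h2, hP, zero_div]), ?_⟩
  simp only [h2, inv_div]

theorem sum {ι : Type*} (s : Finset ι) {f : ι → ℝ → ℂ} (hf : ∀ i ∈ s, IsRationalOn U (f i)) :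
    IsRationalOn U fun ξ => ∑ i ∈ s, f i ξ := by
  classical
  induction s using Finset.induction_on with
  | empty => simpa using const (U := U) 0
  | insert i s hi ih =>
    simp only [Finset.sum_insert hi]
    exact (hf i (by simp)).add (ih fun j hj => hf j (by simp [hj]))

theorem prod {ι : Type*} (s : Finset ι) {f : ι → ℝ → ℂ} (hf : ∀ i ∈ s, IsRationalOn U (f i)) :
    IsRationalOn U fun ξ => ∏ i ∈ s, f i ξ := by
  classical
  induction s using Finset.induction_on with
  | empty => simpa using const (U := U) 1
  | insert i s hi ih =>
    simp only [Finset.prod_insert hi]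
    exact (hf i (by simp)).mul (ih fun j hj => hf j (by simp [hj]))

/-- A rational function on an open set with vanishing derivative is constant, even if the set is
not connected. -/
theorem eq_of_hasDerivAt_zero {f : ℝ → ℂ} (hf : IsRationalOn U f) (hU : IsOpen U)
    (hd : ∀ ξ ∈ U, HasDerivAt f 0 ξ) {ξ₁ ξ₂ : ℝ} (h₁ : ξ₁ ∈ U) (h₂ : ξ₂ ∈ U) : f ξ₁ = f ξ₂ := by
  obtain ⟨P, Q, hPQ⟩ := hf
  obtain ⟨ε, hε, hball⟩ := Metric.isOpen_iff.1 hU ξ₁ h₁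
  have hconst : ∀ ξ ∈ Metric.ball ξ₁ ε, f ξ = f ξ₁ := fun ξ hξ =>
    Metric.isOpen_ball.is_const_of_deriv_eq_zero (convex_ball ξ₁ ε).isPreconnected
      (fun x hx => (hd x (hball hx)).differentiableAt.differentiableWithinAt)
      (fun x hx => (hd x (hball hx)).deriv) hξ (Metric.mem_ball_self hε)
  -- The identity P = f(ξ₁) Q holds on a whole ball, hence as polynomials; this carries the constant
  -- to the other components of U.
  have hzero : P - Polynomial.C (f ξ₁) * Q = 0 := by
    refine Polynomial.eq_zero_of_infinite_isRoot _ (Set.Infinite.mono ?_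
      ((infinite_of_mem_nhds ξ₁ (Metric.ball_mem_nhds ξ₁ hε)).image
        Complex.ofReal_injective.injOn))
    rintro _ ⟨ξ, hξ, rfl⟩
    obtain ⟨h1, h2⟩ := hPQ ξ (hball hξ)
    rw [hconst ξ hξ, eq_div_iff h1] at h2
    simp [Polynomial.IsRoot, h2]
  obtain ⟨h1, h2⟩ := hPQ ξ₂ h₂
  rw [h2, sub_eq_zero.1 hzero, Polynomial.eval_mul, Polynomial.eval_C, mul_div_cancel_right₀ _ h1]

end IsRationalOn

/-! ### Dependence of the amplitude on the gauge parameter -/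

section Rational

variable {G M : Type*} [Fintype G] [Fintype M] [DecidableEq M] {Th : FeynmanRules G M}
variable {E : Type*} [Fintype E] [LinearOrder E] {legs : E → Th.Leg}

/-- Only the denominator that moves with ξ has to be nonzero; the pole at p² = m² sits in a constant
factor. -/
theorem isRationalOn_propagator {U : Set ℝ} {p : Momentum}
    (hp : ∀ ξ ∈ U, ∀ a, msq p ≠ ξ * Th.mass a ^ 2) (c c' : Th.Comp) :
    IsRationalOn U fun ξ => Th.propagator ξ p c c' := by
  have hinv : ∀ a, IsRationalOn U fun ξ =>
      ((msq p : ℂ) + -(Th.mass a ^ 2 : ℂ) * (ξ : ℂ))⁻¹ := fun a =>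
    ((IsRationalOn.const _).add ((IsRationalOn.const _).mul IsRationalOn.ofReal)).inv
      fun ξ hξ h => hp ξ hξ a (by
        have h' : msq p + -(Th.mass a ^ 2) * ξ = 0 := by exact_mod_cast h
        linarith)
  rcases c with ⟨a, μ⟩ | ⟨a, ha⟩ | i <;> rcases c' with ⟨b, ν⟩ | ⟨b, hb⟩ | j <;>
    simp only [propagator] <;> try exact IsRationalOn.const _
  · by_cases h : a = b
    · simp only [if_pos h]
      refine (IsRationalOn.mul (IsRationalOn.const (-Complex.I / ((msq p - Th.mass a ^ 2 : ℝ) : ℂ)))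
        ((IsRationalOn.const (metric μ ν : ℂ)).add
        ((((IsRationalOn.const (-1)).add IsRationalOn.ofReal).mul
          (IsRationalOn.const ((p μ : ℂ) * p ν))).mul (hinv a)))).congr fun ξ _ => ?_
      push_cast
      ring
    · simp only [if_neg h]
      exact IsRationalOn.const _
  · by_cases h : a = b
    · simp only [if_pos h]
      refine ((IsRationalOn.const Complex.I).mul (hinv a)).congr fun ξ _ => ?_
      push_cast
      ring
    · simp only [if_neg h]
      exact IsRationalOn.const _

theorem isRationalOn_amplitude :
    IsRationalOn {ξ | Th.NonSingular ξ legs} fun ξ => Th.amplitude ξ legs := by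
  unfold amplitude
  refine IsRationalOn.sum _ fun T hT => IsRationalOn.sum _ fun f _ => ?_
  have hT' := mem_treeDiagrams.1 hT
  have hf : f = fun h => extendLabels hT'.biUnion_nonempty f h.1 :=
    funext fun h => (extendLabels_val _ f h).symm
  rw [hf]
  simp only [diagramTerm_eq_treeTerm _ legs hT']
  refine ((IsRationalOn.const _).mul (IsRationalOn.prod _ fun A hA =>
    (IsRationalOn.const _).mul (isRationalOn_propagator (fun ξ hξ a => ?_) _ _))).mul
    (IsRationalOn.const _)
  have hc := two_le_card_of_mem_lines hT' hA
  exact ((hξ A hc.1 hc.2).1 a).2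

/-- There are finitely many conditions, and those that involve ξ exclude equality with a continuous
function of ξ. -/
theorem isOpen_nonSingular : IsOpen {ξ | Th.NonSingular ξ legs} := by
  rw [isOpen_iff_eventually]
  intro ξ hξ
  have h : ∀ S : Finset E, ∀ a : G, 2 ≤ S.card → 2 ≤ Sᶜ.card →
      ∀ᶠ ξ' in nhds ξ, msq (momentum legs S) ≠ ξ' * Th.mass a ^ 2 := by
    intro S a h1 h2
    have hcont : Continuous fun ξ' : ℝ => ξ' * Th.mass a ^ 2 := by fun_prop
    filter_upwards [hcont.continuousAt.eventually_ne ((hξ S h1 h2).1 a).2.symm] with ξ' h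
    exact h.symm
  have h' : ∀ᶠ ξ' in nhds ξ, ∀ S : Finset E, ∀ a : G, 2 ≤ S.card → 2 ≤ Sᶜ.card →
      msq (momentum legs S) ≠ ξ' * Th.mass a ^ 2 := by
    simp only [Filter.eventually_all]
    exact h
  filter_upwards [h'] with ξ' h'
  exact fun S h1 h2 => ⟨fun a => ⟨((hξ S h1 h2).1 a).1, h' S a h1 h2⟩, (hξ S h1 h2).2⟩

end Rational

end FeynmanRules

end RxiGauge

end

theorem mainTheorem4 {G M : Type*} [Fintype G] [Fintype M] [DecidableEq M]
    (Th : RxiGauge.FeynmanRules G M) {E : Type*} [Fintype E] [LinearOrder E]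
    (legs : E → Th.Leg) (hmom : ∑ e, (legs e).mom = 0) :
    -- no double counting: a diagram with a marked internal line is, in exactly one way,
    -- a pair of diagrams joined by that line
    (∀ S : Finset E, 2 ≤ S.card → 2 ≤ Sᶜ.card →
      Set.BijOn (RxiGauge.joinDiagrams S)
        {T | RxiGauge.IsTreeDiagram T.1 ∧ RxiGauge.IsTreeDiagram T.2}
        {T | RxiGauge.IsTreeDiagram T ∧ RxiGauge.HasLine T S}) ∧
    -- the terms linear in the variation of the gauge parameter factorize into complete
    -- subamplitudes joined by one unphysical propagator
    (∀ ξ₀ : ℝ, Th.NonSingular ξ₀ legs →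
      HasDerivAt (fun ξ : ℝ => Th.amplitude ξ legs) (Th.unphysicalExchange ξ₀ legs) ξ₀) ∧
    -- for physical external particles the Ward identities imply gauge parameter independence,
    -- first for infinitesimal, then for finite changes
    ((∀ e, (legs e).IsPhysical) →
      (∀ ξ₀ : ℝ, Th.NonSingular ξ₀ legs → Th.SubWardIdentities ξ₀ legs →
        HasDerivAt (fun ξ : ℝ => Th.amplitude ξ legs) 0 ξ₀) ∧
      ((∀ ξ : ℝ, Th.NonSingular ξ legs → Th.SubWardIdentities ξ legs) →
        ∀ ξ₁ ξ₂ : ℝ, Th.NonSingular ξ₁ legs → Th.NonSingular ξ₂ legs →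
          Th.amplitude ξ₁ legs = Th.amplitude ξ₂ legs)) := by
  have deriv_zero : ∀ ξ₀ : ℝ, Th.NonSingular ξ₀ legs → Th.SubWardIdentities ξ₀ legs →
      HasDerivAt (fun ξ : ℝ => Th.amplitude ξ legs) 0 ξ₀ := fun ξ₀ hξ hW =>
    (RxiGauge.FeynmanRules.hasDerivAt_amplitude hmom hξ).congr_deriv
      (RxiGauge.FeynmanRules.unphysicalExchange_eq_zero hmom hW)
  refine ⟨fun S h1 h2 => RxiGauge.bijOn_joinDiagrams (Finset.card_pos.1 (by omega))
    (Finset.card_pos.1 (by omega)),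
    fun ξ₀ hξ => RxiGauge.FeynmanRules.hasDerivAt_amplitude hmom hξ,
    fun _ => ⟨deriv_zero, fun hW ξ₁ ξ₂ h₁ h₂ => ?_⟩⟩
  exact RxiGauge.FeynmanRules.isRationalOn_amplitude.eq_of_hasDerivAt_zero
    RxiGauge.FeynmanRules.isOpen_nonSingular (fun ξ hξ => deriv_zero ξ hξ (hW ξ hξ)) h₁ h₂
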